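/- Consider two-way deterministic machines whose read-only input $w \in \Sigma^*$ (with $\Sigma$ a finite alphabet) is placed between two end markers, and which accept by moving off the tape past the right end marker in a final state. Transitions depend on the state, the scanned tape symbol and the store, and at most one applies in any configuration. A one-counter machine has as its store one nonnegative integer, which is initially $0$, can be tested for zero, and is changed by $-1$, $0$ or $+1$ in each transition (and is not decremented at zero). A pushdown automaton has as its store a pushdown over a finite alphabet $\Gamma$, which initially holds a bottom symbol $Z_0 \in \Gamma$; it is one-turn if it never pushes after it has popped. The store language $S(M)$ of a machine $M$ is the set of all words $q\gamma$ such that, in some accepting computation of $M$ on some input, there is a configuration with state $q$ and store contents $\gamma$ (where $\gamma = C^z$ if the store is a counter with value $z$, and $\gamma$ is the pushdown contents from bottom to top if the store is a pushdown). $M$ is finite-crossing if there is a constant $k$ such that, in every accepting computation, the input head crosses the boundary between any two adjacent tape cells at most $k$ times. A language $L \subseteq \Sigma^*$ is bounded if $L \subseteq w_1^* \cdots w_n^*$ for some nonempty words $w_1, \ldots, w_n$. Then: 1. There is a two-way deterministic one-counter machine $M$ such that the language accepted by $M$ is bounded and $S(M)$ is not recursive. 2. There is a finite-crossing two-way deterministic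 one-counter machine $M$ such that $S(M)$ is not recursive. 3. There is a finite-crossing two-way deterministic one-turn pushdown automaton $M$ such that $S(M)$ is not recursive. -/

import Mathlib

namespace TwoWay

/-- A type of storage: `S` are the store contents, `T` is what a transition can observe of them,
`I` are the instructions and `C` is the alphabet in which store contents are written as words.
An instruction need not be applicable to every content. -/
structure StoreType (S T I C : Type) where
  init : S
  read : S → Option T
  apply : I → S → Option S
  word : S → List C

/-- The instructions of a counter: add `-1`, `0` or `+1`. -/
inductive CounterInstr where
  | dec
  | keep
  | inc

/-- One counter over the nonnegative integers, tested for being nonzero. It cannot be decremented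
at zero. The content `z` is written `C ^ z` for the single counter symbol `C = ()`. -/
def counterStore : StoreType ℕ Bool CounterInstr Unit where
  init := 0
  read z := some (decide (z ≠ 0))
  apply
    | .dec, 0 => none
    | .dec, z + 1 => some z
    | .keep, z => some z
    | .inc, z => some (z + 1)
  word z := List.replicate z ()

/-- The instructions of a pushdown. -/
inductive PushdownInstr (Γ : Type) where
  | push (a : Γ)
  | pop
  | keep

/-- A pushdown over `Γ` that initially holds the bottom symbol `Z₀` only. Contents are lists with
the top first; only the top is read, and nothing can be read from the empty pushdown. As a word,
the contents are written from bottom to top. -/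
def pushdownStore {Γ : Type} (Z₀ : Γ) : StoreType (List Γ) Γ (PushdownInstr Γ) Γ where
  init := [Z₀]
  read s := s.head?
  apply
    | .push a, s => some (a :: s)
    | .pop, [] => none
    | .pop, _ :: s => some s
    | .keep, s => some s
  word s := s.reverse

/-- The symbols on a two-way input tape: letters and the two end markers. -/
inductive TapeSym (A : Type) where
  | leftEnd
  | letter (a : A)
  | rightEnd

/-- The symbol in cell `i` of the tape that holds `w` between the two end markers. The left end
marker is in cell `0` and the right one in cell `w.length + 1`; there are no other cells. -/
def tapeAt {A : Type} (w : List A) (i : ℕ) : Option (TapeSym A) :=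
  (TapeSym.leftEnd :: (w.map TapeSym.letter ++ [TapeSym.rightEnd]))[i]?

/-- The moves of the input head. -/
inductive Dir where
  | left
  | stay
  | right

/-- The new head position; the head cannot move to the left of the left end marker. -/
def Dir.move : Dir → ℕ → Option ℕ
  | .left, 0 => none
  | .left, i + 1 => some i
  | .stay, i => some i
  | .right, i => some (i + 1)

/-- A configuration on a given input: the state, the position of the input head and the store. -/
structure Config (Q S : Type) where
  state : Q
  pos : ℕ
  store : S

/-- A two-way deterministic machine with input alphabet `A`, states `Q` and a store of type `st`.
The state, the scanned tape symbol and the observed part of the store determine at most one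
transition. -/
structure Machine (A Q : Type) {S T I C : Type} (st : StoreType S T I C) where
  start : Q
  final : Set Q
  trans : Q → TapeSym A → T → Option (Q × I × Dir)

namespace Machine

variable {A Q S T I C : Type} {st : StoreType S T I C}

/-- The initial configuration; the head scans the left end marker. -/
def initConfig (M : Machine A Q st) : Config Q S :=
  ⟨M.start, 0, st.init⟩

/-- The successor of a configuration on input `w`, if there is one. -/
def step (M : Machine A Q st) (w : List A) (c : Config Q S) : Option (Config Q S) := do
  let a ← tapeAt w c.pos
  let t ← st.read c.store
  let (q, i, d) ← M.trans c.state a t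
  let p ← d.move c.pos
  let s ← st.apply i c.store
  return ⟨q, p, s⟩

/-- `c 0, …, c n` is a computation on input `w`. -/
def IsComputation (M : Machine A Q st) (w : List A) (c : ℕ → Config Q S) (n : ℕ) : Prop :=
  c 0 = M.initConfig ∧ ∀ j < n, M.step w (c j) = some (c (j + 1))

/-- `c 0, …, c n` is an accepting computation on input `w`: it ends in a final state with the head
having fallen off the tape past the right end marker. -/
def IsAccepting (M : Machine A Q st) (w : List A) (c : ℕ → Config Q S) (n : ℕ) : Prop :=
  M.IsComputation w c n ∧ (c n).state ∈ M.final ∧ (c n).pos = w.length + 2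

/-- The accepted language. -/
def language (M : Machine A Q st) : Language A :=
  {w | ∃ c n, M.IsAccepting w c n}

/-- The store language: all words `q γ`, with `q` the state and `γ` the store content of some
configuration in some accepting computation. -/
def storeLanguage (M : Machine A Q st) : Language (Q ⊕ C) :=
  {u | ∃ w c n, M.IsAccepting w c n ∧
    ∃ j ≤ n, u = Sum.inl (c j).state :: (st.word (c j).store).map Sum.inr}

/-- The number of times that the input head crosses the boundary between the cells `r` and `r + 1`
in `c 0, …, c n`. -/
def crossings (c : ℕ → Config Q S) (n r : ℕ) : ℕ :=
  ((Finset.range n).filter fun j =>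
    ((c j).pos = r ∧ (c (j + 1)).pos = r + 1) ∨
      ((c j).pos = r + 1 ∧ (c (j + 1)).pos = r)).card

/-- The machine is finite-crossing: there is one bound on the number of crossings of every boundary
in all accepting computations. -/
def FiniteCrossing (M : Machine A Q st) : Prop :=
  ∃ k : ℕ, ∀ w c n, M.IsAccepting w c n → ∀ r, crossings c n r ≤ k

end Machine

/-- Two-way deterministic one-counter machines. -/
abbrev CounterMachine (A Q : Type) := Machine A Q counterStore

/-- Two-way deterministic pushdown automata. -/
abbrev PushdownMachine (A Q : Type) {Γ : Type} (Z₀ : Γ) := Machine A Q (pushdownStore Z₀)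

/-- The pushdown automaton is one-turn: in no computation does it push after it has popped. -/
def PushdownMachine.OneTurn {A Q Γ : Type} {Z₀ : Γ} (M : PushdownMachine A Q Z₀) : Prop :=
  ∀ w c n, M.IsComputation w c n → ∀ i j, i < j → j < n →
    (c (i + 1)).store.length < (c i).store.length →
      ¬ (c j).store.length < (c (j + 1)).store.length

/-- A language is bounded if it is contained in `w₁* ⋯ wₖ*` for some nonempty words `wᵢ`. -/
def IsBounded {A : Type} (L : Language A) : Prop :=
  ∃ ws : List (List A), (∀ w ∈ ws, w ≠ []) ∧
    L ≤ (ws.map fun w => KStar.kstar ({w} : Language A)).prod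

/-- A language is recursive if membership in it is decidable by an algorithm. -/
def IsRecursive {A : Type} [Primcodable A] (L : Language A) : Prop :=
  ComputablePred fun u : List A => u ∈ L

end TwoWay

/-! All three parts reduce an undecidable halting problem to membership in a store language. The
problem is that of a generalized Collatz map, which sends `x` to `a * (x / m) + b` with `(a, b)`
depending on `x % m`, and stops at residues without coefficients (`exists_conwayHalts_undecidable`).
It arises by computing a partial recursive function with undecidable domain by a while program,
compiling this to a counter program, and storing the registers as exponents of primes in a single
number; a suitable residue of that number, combined with the label, shows which registers are zero.

Each machine loads the length `n` of the first block of its input into the store, is then in state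
`mark` with exactly this content, and from there accepts only if the iteration from `n` ends.
Conversely, if it ends, some input with first block `n` is accepted; the rest of the input is an
existential witness. Hence `mark` followed by the store word for `n` lies in the store language if
and only if the iteration from `n` ends (the three lemmas `mark_mem_storeLanguage`), and
`not_isRecursive` concludes.

The machines differ in the witness. For a bounded language it is mere space, a tail of ones: the
head position serves as a second counter, and two counters can run the map. For finite crossing it
is the history of the iteration in unary; one counter suffices to compare adjacent blocks, at the
cost of a bounded number of passes over each. The one-turn pushdown automaton pushes the whole
history and compares while reading the input backwards, its pushdown being one block ahead.

Soundness is an invariant (`Inv`): if the iteration ends from the number now represented, then it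
ends from `n`. Completeness builds the accepting run backwards from its end. The machines are
written with infinitely many states; as the coefficients are bounded, a finite set of states is
closed under transitions, and `exists_fin_machine` renumbers it. -/

namespace TwoWay

/-! ### While programs compute all partial recursive functions. -/

/-- While programs over registers indexed by `ℕ`; `loop i c` repeats "decrement register `i`, then
run `c`" as long as register `i` is nonzero. -/
inductive Cmd where
  | skip
  | inc (i : ℕ)
  | seq (c d : Cmd)
  | loop (i : ℕ) (c : Cmd)

namespace Cmd

open Function

/-- `Runs c s s'`: started with register contents `s`, the program `c` terminates with `s'`. -/
inductive Runs : Cmd → (ℕ → ℕ) → (ℕ → ℕ) → Prop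
  | skip (s) : Runs skip s s
  | inc (i s) : Runs (inc i) s (update s i (s i + 1))
  | seq {c d s t u} : Runs c s t → Runs d t u → Runs (seq c d) s u
  | loop_zero {i c s} : s i = 0 → Runs (loop i c) s s
  | loop_succ {i c s n t u} : s i = n + 1 → Runs c (update s i n) t → Runs (loop i c) t u →
      Runs (loop i c) s u

/-- By determinism one exhibited run describes all runs, which is what the equivalence in
`Implements` demands; it is used through `Runs.iff_eq`. -/
theorem Runs.det {c s t} (h : Runs c s t) : ∀ {u}, Runs c s u → t = u := by
  induction h with
  | skip => intro u h; cases h; rfl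
  | inc => intro u h; cases h; rfl
  | seq _ _ ih₁ ih₂ =>
    intro u h
    cases h with
    | seq h₁ h₂ => cases ih₁ h₁; exact ih₂ h₂
  | loop_zero h0 =>
    intro u h
    cases h with
    | loop_zero => rfl
    | loop_succ h1 => omega
  | loop_succ h0 _ _ ih₁ ih₂ =>
    intro u h
    cases h with
    | loop_zero => omega
    | loop_succ h1 h₁ h₂ =>
      obtain rfl : _ = _ := Nat.succ.inj (h0.symm.trans h1)
      cases ih₁ h₁
      exact ih₂ h₂

theorem Runs.iff_eq {c s t} (h : Runs c s t) {u} : Runs c s u ↔ u = t :=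
  ⟨fun h' => (h.det h').symm, fun e => e ▸ h⟩

theorem Runs.congr {c s t s' t'} (h : Runs c s t) (hs : s = s') (ht : t = t') : Runs c s' t' :=
  hs ▸ ht ▸ h

theorem runs_seq {c d s u} : Runs (seq c d) s u ↔ ∃ t, Runs c s t ∧ Runs d t u :=
  ⟨fun h => by cases h with | seq h₁ h₂ => exact ⟨_, h₁, h₂⟩, fun ⟨_, h₁, h₂⟩ => .seq h₁ h₂⟩

/-- A loop whose body takes `F (t + 1)`, with the loop register decremented, to `F t`. -/
theorem runs_loop_of {i : ℕ} {c : Cmd} (F : ℕ → ℕ → ℕ) (hi : ∀ t, F t i = t) (n : ℕ)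
    (h : ∀ t < n, Runs c (update (F (t + 1)) i t) (F t)) : Runs (loop i c) (F n) (F 0) := by
  induction n with
  | zero => exact .loop_zero (hi 0)
  | succ n ih =>
    exact .loop_succ (hi _) (h n (by omega)) (ih fun t ht => h t (by omega))

/-- Set register `i` to zero. -/
def clear (i : ℕ) : Cmd := loop i skip

theorem runs_clear (i : ℕ) (s : ℕ → ℕ) : Runs (clear i) s (update s i 0) := by
  have := runs_loop_of (i := i) (c := skip) (fun t => update s i t) (by simp) (s i)
    (fun t _ => by simpa using Runs.skip _)
  simpa [clear] using this

/-- Add register `i` to register `j` and set register `i` to zero. -/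
def move (i j : ℕ) : Cmd := loop i (inc j)

theorem runs_move {i j : ℕ} (h : i ≠ j) (s : ℕ → ℕ) :
    Runs (move i j) s (update (update s i 0) j (s j + s i)) := by
  have := runs_loop_of (i := i) (c := inc j)
    (fun t => update (update s i t) j (s j + (s i - t))) (by simp [h]) (s i)
    (fun t ht => by
      convert Runs.inc j _ using 1
      ext l
      simp only [update_apply]
      split_ifs <;> omega)
  simpa [move] using this

/-- Add register `i` to register `j`, with the aid of a register `k` that holds zero. -/
def copy (i j k : ℕ) : Cmd := seq (loop i (seq (inc j) (inc k))) (move k i)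

theorem runs_copy {i j k : ℕ} (hij : i ≠ j) (hik : i ≠ k) (hjk : j ≠ k) (s : ℕ → ℕ)
    (hk : s k = 0) : Runs (copy i j k) s (update s j (s j + s i)) := by
  have h1 := runs_loop_of (i := i) (c := seq (inc j) (inc k))
    (fun t => update (update (update s i t) j (s j + (s i - t))) k (s i - t))
    (by simp [hij, hik]) (s i)
    (fun t ht => by
      refine .seq (.inc _ _) ?_
      convert Runs.inc k _ using 1
      ext l
      simp only [update_apply]
      split_ifs <;> omega)
  refine .seq (t := update (update (update s i 0) j (s j + s i)) k (s i)) ?_ ?_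
  · exact h1.congr (by simp [hk]) (by simp)
  · convert runs_move hik.symm _ using 1
    ext l
    simp only [update_apply]
    split_ifs <;> simp_all

/-- If all registers from `k` on are zero, then the program `c` puts into register `k` the value of
`f` at the contents of the registers `ins`, and changes no other register; it terminates if and only
if there is such a value. -/
def Implements {n : ℕ} (c : Cmd) (k : ℕ) (ins : Fin n → ℕ) (f : List.Vector ℕ n →. ℕ) : Prop :=
  ∀ s : ℕ → ℕ, (∀ j, k ≤ j → s j = 0) → ∀ s',
    Runs c s s' ↔ ∃ y ∈ f (List.Vector.ofFn fun i => s (ins i)), s' = update s k y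

/-- Every choice of argument registers admits a program for `f`. -/
def Implementable {n : ℕ} (f : List.Vector ℕ n →. ℕ) : Prop :=
  ∀ (k : ℕ) (ins : Fin n → ℕ), (∀ i, ins i < k) → ∃ c, Implements c k ins f

theorem implements_total {n : ℕ} {c : Cmd} {k : ℕ} {ins : Fin n → ℕ} {f : List.Vector ℕ n → ℕ}
    (h : ∀ s : ℕ → ℕ, (∀ j, k ≤ j → s j = 0) →
      Runs c s (update s k (f (List.Vector.ofFn fun i => s (ins i))))) :
    Implements c k ins (fun v => Part.some (f v)) := by
  intro s hs s'
  rw [(h s hs).iff_eq]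
  simp

theorem Implements.runs {n : ℕ} {c : Cmd} {k : ℕ} {ins : Fin n → ℕ} {f : List.Vector ℕ n → ℕ}
    (h : Implements c k ins (fun v => Part.some (f v))) {s : ℕ → ℕ} (hs : ∀ j, k ≤ j → s j = 0) :
    Runs c s (update s k (f (List.Vector.ofFn fun i => s (ins i)))) :=
  (h s hs _).2 ⟨_, Part.mem_some _, rfl⟩

theorem mem_mOfFn {n : ℕ} {g : Fin n → Part ℕ} {v : List.Vector ℕ n} :
    v ∈ List.Vector.mOfFn g ↔ ∀ i, v.get i ∈ g i := by
  induction n with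
  | zero =>
    simp only [List.Vector.mOfFn, IsEmpty.forall_iff, iff_true]
    rw [v.eq_nil]
    exact Part.mem_some _
  | succ n ih =>
    simp only [List.Vector.mOfFn, Part.bind_eq_bind, Part.mem_bind_iff, Fin.forall_fin_succ]
    constructor
    · rintro ⟨a, ha, w, hw, h⟩
      obtain rfl : v = a ::ᵥ w := Part.mem_some_iff.1 h
      exact ⟨by simpa using ha, by simpa using ih.1 hw⟩
    · rintro ⟨h0, h1⟩
      refine ⟨v.head, by simpa using h0, v.tail, ih.2 fun i => by simpa using h1 i, ?_⟩
      exact Part.mem_some_iff.2 (by simp)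

/-- Run `c 0`, …, `c (l - 1)`. -/
def seqs (c : ℕ → Cmd) : ℕ → Cmd
  | 0 => skip
  | l + 1 => seq (seqs c l) (c l)

/-- The contents `s` with `ys 0, …, ys (l - 1)` written to the registers from `k` on. -/
def overwrite (s : ℕ → ℕ) (k l : ℕ) (ys : ℕ → ℕ) : ℕ → ℕ :=
  fun j => if k ≤ j ∧ j < k + l then ys (j - k) else s j

theorem runs_clears (k l : ℕ) (s : ℕ → ℕ) :
    Runs (seqs (fun i => clear (k + i)) l) s (overwrite s k l fun _ => 0) := by
  induction l with
  | zero =>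
    refine (Runs.skip s).congr rfl ?_
    ext j
    simp only [overwrite]
    rw [if_neg (by omega)]
  | succ l ih =>
    refine .seq ih ?_
    convert runs_clear (k + l) _ using 1
    ext j
    simp only [overwrite, update_apply]
    split_ifs <;> omega

/-- The values of the `g i` go to the registers `k + 1 + i`, each computed with the earlier ones
protected below its own work space, and the value of `f` goes to `k + 1 + n`. Register `k` stays
free for the result, which is moved there before the intermediate values are erased. -/
theorem implementable_comp {m n : ℕ} {f : List.Vector ℕ n →. ℕ}
    (g : Fin n → List.Vector ℕ m →. ℕ) (hf : Implementable f) (hg : ∀ i, Implementable (g i)) :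
    Implementable fun v => (List.Vector.mOfFn fun i => g i v) >>= f := by
  intro k ins hins
  choose c hc using fun i : Fin n => hg i (k + 1 + i) ins fun j => by have := hins j; omega
  obtain ⟨d, hd⟩ := hf (k + 1 + n) (fun i => k + 1 + i) fun i => by omega
  -- Indexing by `ℕ`, with an idle program from `n` on, allows induction on the number of arguments
  -- already evaluated.
  let c' : ℕ → Cmd := fun l => if h : l < n then c ⟨l, h⟩ else skip
  refine ⟨seq (seqs c' n) (seq d (seq (move (k + 1 + n) k)
    (seqs (fun i => clear (k + 1 + i)) n))), fun s hs s' => ?_⟩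
  have args : ∀ l ≤ n, ∀ s', Runs (seqs c' l) s s' ↔
      ∃ ys : ℕ → ℕ, (∀ i : Fin n, i < l → ys i ∈ g i (List.Vector.ofFn fun i => s (ins i))) ∧
        s' = overwrite s (k + 1) l ys := by
    intro l
    induction l with
    | zero =>
      intro _ s'
      rw [seqs, (Runs.skip s).iff_eq]
      have : ∀ ys, overwrite s (k + 1) 0 ys = s := fun ys => by
        ext j; simp only [overwrite]; rw [if_neg (by omega)]
      simp [this]
    | succ l ih =>
      intro hl s'
      have spec : ∀ ys s', Runs (c' l) (overwrite s (k + 1) l ys) s' ↔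
          ∃ y ∈ g ⟨l, hl⟩ (List.Vector.ofFn fun i => s (ins i)),
            s' = update (overwrite s (k + 1) l ys) (k + 1 + l) y := by
        intro ys s'
        have := hc ⟨l, hl⟩ (overwrite s (k + 1) l ys) (fun j hj => by
          simp only [overwrite]
          rw [if_neg (by simp at hj; omega)]
          exact hs j (by simp at hj; omega)) s'
        have e : ∀ i, overwrite s (k + 1) l ys (ins i) = s (ins i) := fun i => by
          simp only [overwrite]
          rw [if_neg (by have := hins i; omega)]
        simp only [e] at this
        simpa [c', show l < n from hl] using this
      rw [seqs, runs_seq]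
      constructor
      · rintro ⟨t, h1, h2⟩
        obtain ⟨ys, hys, rfl⟩ := (ih (by omega) t).1 h1
        obtain ⟨y, hy, rfl⟩ := (spec _ _).1 h2
        refine ⟨update ys l y, fun i hi => ?_, ?_⟩
        · rcases Nat.lt_succ_iff_lt_or_eq.1 hi with h | h
          · rw [update_of_ne (by omega)]; exact hys i h
          · obtain rfl : i = ⟨l, hl⟩ := Fin.ext h
            simpa using hy
        · ext j
          simp only [overwrite, update_apply]
          split_ifs <;> omega
      · rintro ⟨ys, hys, rfl⟩
        refine ⟨_, (ih (by omega) _).2 ⟨ys, fun i hi => hys i (by omega), rfl⟩,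
          (spec _ _).2 ⟨ys l, hys ⟨l, hl⟩ (by simp), ?_⟩⟩
        ext j
        simp only [overwrite, update_apply]
        split_ifs with h1 h2 h3 <;> first | omega | rfl | skip
        subst h2; simp
  have outer : ∀ ys s', Runs d (overwrite s (k + 1) n ys) s' ↔
      ∃ y ∈ f (List.Vector.ofFn fun i : Fin n => ys i),
        s' = update (overwrite s (k + 1) n ys) (k + 1 + n) y := by
    intro ys s'
    have := hd (overwrite s (k + 1) n ys) (fun j hj => by
      simp only [overwrite]
      rw [if_neg (by omega)]
      exact hs j (by omega)) s'
    have e : ∀ i : Fin n, overwrite s (k + 1) n ys (k + 1 + i) = ys i := fun i => by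
      simp only [overwrite]
      rw [if_pos (by omega)]
      congr 1; omega
    simpa only [e] using this
  have final : ∀ ys y s', Runs (seq (move (k + 1 + n) k) (seqs (fun i => clear (k + 1 + i)) n))
      (update (overwrite s (k + 1) n ys) (k + 1 + n) y) s' ↔ s' = update s k y := by
    intro ys y s'
    rw [((runs_move (i := k + 1 + n) (j := k) (by omega) _).seq (runs_clears _ _ _)).iff_eq]
    suffices h : ∀ a b : ℕ → ℕ, a = b → (s' = a ↔ s' = b) by
      apply h
      ext j
      have hk := hs k le_rfl
      have hj := hs j
      simp only [overwrite, update_apply]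
      split_ifs <;> omega
    rintro a _ rfl; rfl
  simp only [runs_seq, args n le_rfl]
  simp only [← runs_seq (c := move _ _)]
  constructor
  · rintro ⟨_, ⟨ys, hys, rfl⟩, _, h2, h3⟩
    obtain ⟨y, hy, rfl⟩ := (outer _ _).1 h2
    refine ⟨y, ?_, (final _ _ _).1 h3⟩
    exact Part.mem_bind (mem_mOfFn.2 fun i => by simpa using hys i i.2) hy
  · rintro ⟨y, hy, rfl⟩
    obtain ⟨v, hv, hy⟩ := Part.mem_bind_iff.1 hy
    have hv := mem_mOfFn.1 hv
    have e : v = List.Vector.ofFn fun i : Fin n =>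
        (fun l => if h : l < n then v.get ⟨l, h⟩ else 0) (i : ℕ) := by
      ext i; simp
    refine ⟨_, ⟨fun l => if h : l < n then v.get ⟨l, h⟩ else 0, fun i _ => ?_, rfl⟩, _,
      (outer _ _).2 ⟨y, by rwa [e] at hy, rfl⟩, (final _ _ _).2 rfl⟩
    simpa using hv i

/-- Primitive recursion is a loop over a copy of the recursion argument, so the argument itself
survives. The step function reads index and accumulator and answers in `k + 3`, from where the
answer replaces the accumulator. -/
theorem implementable_prec {n : ℕ} {f : List.Vector ℕ n → ℕ} {g : List.Vector ℕ (n + 2) → ℕ}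
    (hf : Implementable fun v => Part.some (f v)) (hg : Implementable fun v => Part.some (g v)) :
    Implementable fun v : List.Vector ℕ (n + 1) => Part.some
      (v.head.rec (f v.tail) fun y IH => g (y ::ᵥ IH ::ᵥ v.tail) : ℕ) := by
  intro k ins hins
  obtain ⟨c, hc⟩ := hf k (fun i => ins i.succ) fun i => hins _
  -- `k` accumulates, `k + 1` counts down, `k + 2` counts up
  obtain ⟨d, hd⟩ := hg (k + 3) (Fin.cons (k + 2) (Fin.cons k fun i => ins i.succ)) (by
    intro i
    refine Fin.cases (by simp) (fun i => Fin.cases (by simp) (fun i => ?_) i) i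
    have := hins i.succ
    simp only [Fin.cons_succ]
    omega)
  refine ⟨seq c (seq (copy (ins 0) (k + 1) (k + 2)) (seq
    (loop (k + 1) (seq d (seq (clear k) (seq (move (k + 3) k) (inc (k + 2))))))
    (clear (k + 2)))), implements_total fun s hs => ?_⟩
  set R : ℕ → ℕ := fun a => a.rec (f (List.Vector.ofFn fun i => s (ins i.succ)))
    fun y IH => g (y ::ᵥ IH ::ᵥ List.Vector.ofFn fun i => s (ins i.succ)) with hR
  have h0 := hins 0
  have hk0 : s k = 0 := hs _ (by omega)
  have hk1 : s (k + 1) = 0 := hs _ (by omega)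
  have hk2 : s (k + 2) = 0 := hs _ (by omega)
  have hk3 : s (k + 3) = 0 := hs _ (by omega)
  -- With `t` rounds left, the index is `s (ins 0) - t` and the accumulator holds the recursion's
  -- value at that index.
  have body := runs_loop_of (i := k + 1)
    (c := seq d (seq (clear k) (seq (move (k + 3) k) (inc (k + 2)))))
    (fun t => update (update (update s k (R (s (ins 0) - t))) (k + 1) t) (k + 2) (s (ins 0) - t))
    (by simp) (s (ins 0)) (fun t ht => by
      refine .seq (hd.runs fun j hj => ?_) (.seq (runs_clear _ _)
        (.seq (runs_move (by omega) _) ?_))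
      · have := hs j (by omega)
        simp only [update_apply]
        split_ifs <;> omega
      · convert Runs.inc (k + 2) _ using 1
        have e : s (ins 0) - t = s (ins 0) - (t + 1) + 1 := by omega
        have hg' : R (s (ins 0) - t) = g (List.Vector.ofFn fun i => update (update (update (update s
            k (R (s (ins 0) - (t + 1)))) (k + 1) (t + 1)) (k + 2) (s (ins 0) - (t + 1)))
            (k + 1) t ((Fin.cons (k + 2) (Fin.cons k fun i => ins i.succ) :
              Fin (n + 2) → ℕ) i)) := by
          rw [e]
          simp only [hR]
          congr 1
          ext i
          rw [List.Vector.get_ofFn]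
          refine Fin.cases (by simp) (fun i => Fin.cases ?_ (fun i => ?_) i) i
          · rw [List.Vector.get_cons_succ]; simp
          have := hins i.succ
          simp only [Fin.cons_succ, List.Vector.get_cons_succ, List.Vector.get_ofFn, update_apply]
          split_ifs <;> omega
        rw [← hg']
        ext j
        have hj := hs j
        simp only [update_apply]
        split_ifs <;> simp_all)
  refine .seq (hc.runs hs) (.seq (runs_copy (by omega) (by omega) (by omega) _ ?_) (.seq
    (t := update (update s k (R (s (ins 0)))) (k + 2) (s (ins 0))) ?_ ?_))
  · simp [hk2]
  · convert body using 1
    · ext j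
      have hj := hs j
      simp only [update_apply]
      split_ifs <;> simp_all [R]
    · ext j
      have hj := hs j
      simp only [update_apply]
      split_ifs <;> simp_all
  · convert runs_clear _ _ using 1
    ext j
    have hj := hs j
    simp only [update_apply]
    split_ifs <;> simp_all [R, List.Vector.ofFn]

/-- Register `k` holds the candidate and `k + 1` the value of `f` at it. The loop continues while
this value is nonzero; its body discards what is left of the value, passes to the next candidate and
evaluates again. -/
theorem implementable_rfind {n : ℕ} {f : List.Vector ℕ (n + 1) → ℕ}
    (hf : Implementable fun v => Part.some (f v)) :
    Implementable fun v => Nat.rfind fun n => Part.some (decide (f (n ::ᵥ v) = 0)) := by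
  intro k ins hins
  obtain ⟨c, hc⟩ := hf (k + 1) (Fin.cons k ins) (by
    intro i
    refine Fin.cases (by simp) (fun i => ?_) i
    have := hins i
    simp only [Fin.cons_succ]
    omega)
  refine ⟨seq c (loop (k + 1) (seq (clear (k + 1)) (seq (inc k) c))), fun s hs s' => ?_⟩
  have hk0 : s k = 0 := hs _ (by omega)
  have hk1 : s (k + 1) = 0 := hs _ (by omega)
  set F : ℕ → ℕ := fun y => f (y ::ᵥ List.Vector.ofFn fun i => s (ins i)) with hF
  have eval : ∀ y, Runs c (update s k y) (update (update s k y) (k + 1) (F y)) := by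
    intro y
    have e : f (List.Vector.ofFn fun i => update s k y ((Fin.cons k ins : Fin (n + 1) → ℕ) i))
        = F y := by
      simp only [hF]
      congr 1
      ext i
      rw [List.Vector.get_ofFn]
      refine Fin.cases (by simp) (fun i => ?_) i
      have := hins i
      simp only [Fin.cons_succ, List.Vector.get_cons_succ, List.Vector.get_ofFn, update_apply]
      split_ifs <;> omega
    refine (hc.runs (s := update s k y) fun j hj => ?_).congr rfl (by rw [e])
    rw [update_of_ne (by omega)]
    exact hs j (by omega)
  have body : ∀ y n, Runs (seq (clear (k + 1)) (seq (inc k) c))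
      (update (update (update s k y) (k + 1) (F y)) (k + 1) n)
      (update (update s k (y + 1)) (k + 1) (F (y + 1))) := by
    intro y n
    refine .seq (runs_clear _ _) (.seq (.inc _ _) ?_)
    refine (eval (y + 1)).congr ?_ rfl
    ext j
    by_cases h1 : j = k <;> by_cases h2 : j = k + 1 <;> simp [h1, h2, hk1]
  set G : ℕ → ℕ → ℕ := fun y => update (update s k y) (k + 1) (F y) with hG
  have hGk : ∀ y, G y (k + 1) = F y := by simp [hG]
  have start : Runs c s (G 0) := by
    convert eval 0 using 1
    rw [← hk0, update_eq_self]
  have up : ∀ y d, (∀ z < d, F (y + z) ≠ 0) → F (y + d) = 0 →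
      Runs (loop (k + 1) (seq (clear (k + 1)) (seq (inc k) c))) (G y) (update s k (y + d)) := by
    intro y d
    induction d generalizing y with
    | zero =>
      intro _ h
      rw [add_zero] at h ⊢
      refine (Runs.loop_zero (s := G y) (by rw [hGk]; exact h)).congr rfl ?_
      ext j
      simp only [hG, update_apply]
      split_ifs <;> simp_all
    | succ d ih =>
      intro h1 h2
      obtain ⟨m, hm⟩ := Nat.exists_eq_succ_of_ne_zero (h1 0 (by omega))
      refine .loop_succ (by rw [hGk]; exact hm) (body y m) ?_
      have := ih (y + 1) (fun z hz => ?_) ?_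
      · convert this using 2; omega
      · have := h1 (z + 1) (by omega)
        convert this using 2; omega
      · convert h2 using 2; omega
  -- Here only termination is known, so the induction is on the run itself, with program and
  -- starting contents generalized to equations.
  have down : ∀ c' t s', Runs c' t s' → ∀ y, t = G y →
      c' = loop (k + 1) (seq (clear (k + 1)) (seq (inc k) c)) → ∃ z, F z = 0 := by
    intro c' t s' h
    induction h with
    | skip | inc | seq => intro y _ h; cases h
    | loop_zero h =>
      rintro y rfl e; cases e
      exact ⟨y, by rwa [hGk] at h⟩
    | @loop_succ _ _ _ m _ _ h h1 h2 _ ih =>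
      rintro y rfl e; cases e
      exact ih (y + 1) (h1.det (body y m)) rfl
  have fin : ∀ h : ∃ z, F z = 0, Runs (seq c (loop (k + 1)
      (seq (clear (k + 1)) (seq (inc k) c)))) s (update s k (Nat.find h)) := by
    intro h
    refine .seq start ?_
    have := up 0 (Nat.find h) (fun z hz => by simpa using Nat.find_min h hz)
      (by simpa using Nat.find_spec h)
    simpa using this
  constructor
  · intro h
    have ex : ∃ z, F z = 0 := by
      obtain ⟨t, h1, h2⟩ := runs_seq.1 h
      exact down _ _ _ h2 0 (h1.det start) rfl
    refine ⟨Nat.find ex, ?_, h.det (fin ex)⟩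
    refine Nat.mem_rfind.2 ⟨?_, fun {m} hm => ?_⟩
    · simpa using Nat.find_spec ex
    · simpa using Nat.find_min ex hm
  · rintro ⟨y, hy, rfl⟩
    replace hy := Nat.mem_rfind.1 hy
    have h0 : F y = 0 := by simpa using hy.1
    have h1 : ∀ z < y, F z ≠ 0 := fun z hz => by simpa using hy.2 hz
    have ex : ∃ z, F z = 0 := ⟨y, h0⟩
    convert fin ex
    symm
    rw [Nat.find_eq_iff]
    exact ⟨h0, h1⟩

theorem implementable_of_primrec' {n : ℕ} {f : List.Vector ℕ n → ℕ} (h : Nat.Primrec' f) :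
    Implementable fun v => Part.some (f v) := by
  induction h with
  | zero =>
    refine fun k ins _ => ⟨skip, implements_total fun s hs => ?_⟩
    convert Runs.skip s using 1
    rw [← hs k le_rfl, update_eq_self]
  | succ =>
    refine fun k ins hins => ⟨seq (copy (ins 0) k (k + 1)) (inc k), implements_total fun s hs => ?_⟩
    have h0 := hins 0
    refine .seq (runs_copy (by omega) (by omega) (by omega) s (hs _ (by omega))) ?_
    convert Runs.inc k _ using 1
    simp [hs k le_rfl, List.Vector.ofFn]
  | get i =>
    refine fun k ins hins => ⟨copy (ins i) k (k + 1), implements_total fun s hs => ?_⟩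
    have h0 := hins i
    refine (runs_copy (by omega) (by omega) (by omega) s (hs _ (by omega))).congr rfl ?_
    simp [hs k le_rfl]
  | comp g _ _ hf hg =>
    have := implementable_comp (fun i v => Part.some (g i v)) hf hg
    refine (congrArg Implementable (funext fun v => ?_)).mp this
    refine Part.eq_some_iff.2 ?_
    exact Part.mem_bind ((mem_mOfFn (v := List.Vector.ofFn fun i => g i v)).2 (by simp))
      (Part.mem_some _)
  | prec _ _ hf hg => exact implementable_prec hf hg

/-- `Nat.Partrec'` applies minimization to total functions only, and primitive recursion occurs only
inside `Nat.Primrec'`. Composition is therefore the only construction that has to cope with partial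
arguments. -/
theorem implementable_of_partrec' {n : ℕ} {f : List.Vector ℕ n →. ℕ} (h : Nat.Partrec' f) :
    Implementable f := by
  induction h with
  | prim h => exact implementable_of_primrec' h
  | comp g _ _ hf hg => exact implementable_comp g hf hg
  | rfind _ hf => exact implementable_rfind hf

end Cmd

/-! ### Counter programs and the compilation of while programs. -/

/-- One instruction of a counter program; `jzdec i q q'` goes to `q'` if register `i` is zero, and
otherwise decrements it and goes to `q`. -/
inductive Instr where
  | inc (i q : ℕ)
  | jzdec (i q q' : ℕ)
  | goto (q : ℕ)

namespace Instr

open Function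

/-- The next label and register contents. -/
def exec : Instr → (ℕ → ℕ) → ℕ × (ℕ → ℕ)
  | inc i q, s => (q, update s i (s i + 1))
  | jzdec i q q', s => if s i = 0 then (q', s) else (q, update s i (s i - 1))
  | goto q, s => (q, s)

/-- The registers of an instruction are less than `N`. -/
def RegLT (N : ℕ) : Instr → Prop
  | inc i _ => i < N
  | jzdec i _ _ => i < N
  | goto _ => True

/-- The labels to which an instruction jumps are less than `L`. -/
def LabelLT (L : ℕ) : Instr → Prop
  | inc _ q => q < L
  | jzdec _ q q' => q < L ∧ q' < L
  | goto q => q < L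

end Instr

/-- The counter program of a while program, placed at label `l`. -/
def Cmd.code : Cmd → ℕ → List Instr
  | skip, _ => []
  | inc i, l => [.inc i (l + 1)]
  | seq c d, l => c.code l ++ d.code (l + (c.code l).length)
  | loop i c, l => .jzdec i (l + 1) (l + 1 + (c.code (l + 1)).length + 1) ::
      (c.code (l + 1) ++ [.goto l])

/-- One step of a counter program; it halts at labels that carry no instruction. -/
def progStep (P : List Instr) (c : ℕ × (ℕ → ℕ)) : Option (ℕ × (ℕ → ℕ)) :=
  P[c.1]?.map fun i => i.exec c.2

/-- `HaltsIn f n c`: iterating `f` from `c` reaches, in `n` steps, a point where `f` is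
undefined. -/
def HaltsIn {α : Type} (f : α → Option α) : ℕ → α → Prop
  | 0, c => f c = none
  | n + 1, c => ∃ c', f c = some c' ∧ HaltsIn f n c'

namespace Cmd

/-- The bound includes the exit label just past the code. Labels will be stored as residues modulo
the code length plus one, so they must not exceed it. -/
theorem code_labelLT (c : Cmd) : ∀ l, ∀ i ∈ c.code l, i.LabelLT (l + (c.code l).length + 1) := by
  have mono : ∀ {L L'} {i : Instr}, L ≤ L' → i.LabelLT L → i.LabelLT L' := by
    intro L L' i h
    cases i <;> simp only [Instr.LabelLT] <;> omega
  induction c with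
  | skip => simp [code]
  | inc => simp [code, Instr.LabelLT]
  | seq c d ihc ihd =>
    intro l i hi
    rw [code, List.mem_append] at hi
    rcases hi with hi | hi
    · exact mono (by simp [code]) (ihc l i hi)
    · exact mono (by simp [code]; omega) (ihd _ i hi)
  | loop j c ih =>
    intro l i hi
    simp only [code, List.mem_cons, List.mem_append, List.not_mem_nil, or_false] at hi
    rcases hi with rfl | hi | rfl
    · simp only [Instr.LabelLT, code, List.length_cons, List.length_append, List.length_nil]
      omega
    · exact mono (by simp [code]; omega) (ih _ i hi)
    · simp only [Instr.LabelLT]; omega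

theorem progStep_of_get {P pre post : List Instr} {i : Instr} (hP : P = pre ++ i :: post)
    (s : ℕ → ℕ) : progStep P (pre.length, s) = some (i.exec s) := by
  simp [progStep, hP]

/-- A terminating while program is simulated by its code. -/
theorem Runs.haltsIn {c s s'} (h : Runs c s s') : ∀ {P pre post : List Instr},
    P = pre ++ c.code pre.length ++ post → ∀ {n},
    HaltsIn (progStep P) n (pre.length + (c.code pre.length).length, s') →
    ∃ n, HaltsIn (progStep P) n (pre.length, s) := by
  induction h with
  | skip s => intro P pre post hP n h; exact ⟨n, h⟩
  | inc i s =>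
    intro P pre post hP n h
    refine ⟨n + 1, _, progStep_of_get (i := .inc i (pre.length + 1)) (post := post) ?_ s, ?_⟩
    · simpa [code] using hP
    · simpa [code, Instr.exec] using h
  | @seq c d _ _ _ _ _ ih₁ ih₂ =>
    intro P pre post hP n h
    have := ih₂ (P := P) (pre := pre ++ c.code pre.length) (post := post)
      (by simp [hP, code]) (n := n) (by convert h using 2; simp [code]; omega)
    obtain ⟨n', hn'⟩ := this
    exact ih₁ (post := d.code (pre.length + (c.code pre.length).length) ++ post)
      (by simp [hP, code]) (n := n') (by convert hn' using 2; simp)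
  | @loop_zero i c s h0 =>
    intro P pre post hP n h
    refine ⟨n + 1, _, progStep_of_get (P := P) (pre := pre)
      (i := .jzdec i (pre.length + 1) (pre.length + 1 + (c.code (pre.length + 1)).length + 1))
      (by simp [hP, code]; rfl) s, ?_⟩
    convert h using 1
    simp [Instr.exec, h0, code]
    omega
  | @loop_succ i c s m t u h0 _ _ ih₁ ih₂ =>
    intro P pre post hP n h
    obtain ⟨n', hn'⟩ := ih₂ hP h
    have back : HaltsIn (progStep P) (n' + 1)
        (pre.length + 1 + (c.code (pre.length + 1)).length, t) := by
      refine ⟨_, ?_, hn'⟩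
      have := progStep_of_get (P := P) (pre := pre ++ .jzdec i (pre.length + 1)
        (pre.length + 1 + (c.code (pre.length + 1)).length + 1) :: c.code (pre.length + 1))
        (i := .goto pre.length) (post := post) (by simp [hP, code]) t
      simpa [Instr.exec, add_assoc, add_comm 1] using this
    have := ih₁ (P := P) (pre := pre ++ [.jzdec i (pre.length + 1)
        (pre.length + 1 + (c.code (pre.length + 1)).length + 1)]) (post := .goto pre.length :: post)
        (by simp [hP, code]) (n := n' + 1) (by simpa using back)
    obtain ⟨n'', hn''⟩ := this
    refine ⟨n'' + 1, _, progStep_of_get (P := P) (pre := pre)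
      (i := .jzdec i (pre.length + 1) (pre.length + 1 + (c.code (pre.length + 1)).length + 1))
      (by simp [hP, code]; rfl) s, ?_⟩
    simpa [Instr.exec, h0] using hn''

/-- If the code of a while program, followed by anything, halts, then the while program
terminates. -/
theorem runs_of_haltsIn (c : Cmd) : ∀ {P pre post : List Instr},
    P = pre ++ c.code pre.length ++ post → ∀ {n s}, HaltsIn (progStep P) n (pre.length, s) →
    ∃ s', Runs c s s' ∧ ∃ n' ≤ n,
      HaltsIn (progStep P) n' (pre.length + (c.code pre.length).length, s') := by
  induction c with
  | skip => intro P pre post hP n s h; exact ⟨s, .skip s, n, le_rfl, h⟩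
  | inc i =>
    intro P pre post hP n s h
    have hs := progStep_of_get (P := P) (pre := pre) (i := .inc i (pre.length + 1)) (post := post)
      (by simpa [code] using hP) s
    cases n with
    | zero => simp [HaltsIn, hs] at h
    | succ n =>
      obtain ⟨c', h1, h2⟩ := h
      rw [hs] at h1
      cases h1
      exact ⟨_, .inc i s, n, by omega, by simpa [code, Instr.exec] using h2⟩
  | seq c d ihc ihd =>
    intro P pre post hP n s h
    obtain ⟨t, ht, n', hn', h'⟩ := ihc
      (post := d.code (pre.length + (c.code pre.length).length) ++ post)
      (by simp [hP, code]) h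
    obtain ⟨u, hu, n'', hn'', h''⟩ := ihd (P := P) (pre := pre ++ c.code pre.length) (post := post)
      (by simp [hP, code]) (n := n') (s := t) (by convert h' using 2; simp)
    exact ⟨u, .seq ht hu, n'', by omega, by convert h'' using 2; simp [code]; omega⟩
  | loop i c ih =>
    intro P pre post hP n
    -- Every round of the loop consumes steps of the halting computation; the bound `n' ≤ n` in the
    -- conclusion exists to feed this induction.
    induction n using Nat.strong_induction_on with
    | _ n ihn =>
      intro s h
      have hs := progStep_of_get (P := P) (pre := pre)
        (i := .jzdec i (pre.length + 1) (pre.length + 1 + (c.code (pre.length + 1)).length + 1))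
        (by simp [hP, code]; rfl) s
      cases n with
      | zero => simp [HaltsIn, hs] at h
      | succ n =>
        obtain ⟨c', h1, h2⟩ := h
        rw [hs] at h1
        cases h1
        by_cases h0 : s i = 0
        · refine ⟨s, .loop_zero h0, n, by omega, ?_⟩
          convert h2 using 1
          simp [Instr.exec, h0, code]
          omega
        · obtain ⟨m, hm⟩ := Nat.exists_eq_succ_of_ne_zero h0
          obtain ⟨t, ht, n', hn', h'⟩ := ih (P := P) (pre := pre ++ [.jzdec i (pre.length + 1)
            (pre.length + 1 + (c.code (pre.length + 1)).length + 1)])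
            (post := .goto pre.length :: post) (by simp [hP, code]) (n := n)
            (s := Function.update s i m) (by simpa [Instr.exec, hm] using h2)
          have hs' := progStep_of_get (P := P) (pre := pre ++ .jzdec i (pre.length + 1)
            (pre.length + 1 + (c.code (pre.length + 1)).length + 1) :: c.code (pre.length + 1))
            (i := .goto pre.length) (post := post) (by simp [hP, code]) t
          have hs' : progStep P (pre.length + 1 + (c.code (pre.length + 1)).length, t)
              = some (pre.length, t) := by
            simpa [Instr.exec, add_assoc, add_comm 1] using hs'
          have h' : HaltsIn (progStep P) n'
              (pre.length + 1 + (c.code (pre.length + 1)).length, t) := by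
            simpa using h'
          cases n' with
          | zero => simp [HaltsIn, hs'] at h'
          | succ n' =>
            obtain ⟨c', h1, h2⟩ := h'
            rw [hs'] at h1
            cases h1
            obtain ⟨u, hu, n'', hn'', h''⟩ := ihn n' (by omega) h2
            exact ⟨u, .loop_succ hm ht hu, n'', by omega, h''⟩

theorem haltsIn_code_iff (c : Cmd) (s : ℕ → ℕ) :
    (∃ n, HaltsIn (progStep (c.code 0)) n (0, s)) ↔ ∃ s', Runs c s s' := by
  constructor
  · rintro ⟨n, h⟩
    obtain ⟨s', hs', -⟩ := runs_of_haltsIn c (P := c.code 0) (pre := []) (post := []) (by simp) h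
    exact ⟨s', hs'⟩
  · rintro ⟨s', h⟩
    exact h.haltsIn (P := c.code 0) (pre := []) (post := []) (by simp) (n := 0)
      (by simp [HaltsIn, progStep])

end Cmd

/-! ### A generalized Collatz map with undecidable halting problem. -/

theorem exists_regLT (P : List Instr) : ∃ N, ∀ i ∈ P, i.RegLT N := by
  have mono : ∀ {L L'} {i : Instr}, L ≤ L' → i.RegLT L → i.RegLT L' := by
    intro L L' i h
    cases i <;> simp only [Instr.RegLT, imp_self] <;> omega
  have one : ∀ i : Instr, ∃ N, i.RegLT N := by
    rintro (⟨i, _⟩ | ⟨i, _, _⟩ | _)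
    exacts [⟨i + 1, Nat.lt_succ_self i⟩, ⟨i + 1, Nat.lt_succ_self i⟩, ⟨0, trivial⟩]
  induction P with
  | nil => exact ⟨0, by simp⟩
  | cons i P ih =>
    obtain ⟨N, hN⟩ := ih
    obtain ⟨N', hN'⟩ := one i
    refine ⟨max N N', fun j hj => ?_⟩
    rcases List.mem_cons.1 hj with rfl | hj
    · exact mono (le_max_right _ _) hN'
    · exact mono (le_max_left _ _) (hN j hj)

/-- Some while program has a halting problem that is undecidable in its first argument. -/
theorem exists_cmd_halting_undecidable :
    ∃ c : Cmd, ¬ ComputablePred fun n : ℕ => ∃ s', Cmd.Runs c (Function.update 0 0 n) s' := by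
  -- The universal function at argument `0`, with `n` read as the code of a program.
  have hp : Nat.Partrec fun n => (Nat.Partrec.Code.ofNatCode n).eval 0 := by
    have := Nat.Partrec.Code.eval_part.comp (Computable.ofNat Nat.Partrec.Code) (Computable.const 0)
    exact Partrec.nat_iff.1 this
  have hp' : Nat.Partrec' fun v : List.Vector ℕ 1 =>
      (Nat.Partrec.Code.ofNatCode v.head).eval 0 := Nat.Partrec'.part_iff₁.2 (Partrec.nat_iff.2 hp)
  obtain ⟨c, hc⟩ := Cmd.implementable_of_partrec' hp' 1 (fun _ => 0) (by simp)
  refine ⟨c, fun h => ComputablePred.halting_problem 0 ?_⟩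
  have key : ∀ n : ℕ, (∃ s', Cmd.Runs c (Function.update 0 0 n) s') ↔
      ((Nat.Partrec.Code.ofNatCode n).eval 0).Dom := by
    intro n
    have := hc (Function.update 0 0 n) (fun j hj => by
      rw [Function.update_of_ne (by omega)]; rfl)
    simp only [this, List.Vector.ofFn, List.Vector.head_cons, Function.update_self]
    constructor
    · rintro ⟨_, y, hy, -⟩
      exact Part.dom_iff_mem.2 ⟨y, hy⟩
    · intro h
      exact ⟨_, _, Part.get_mem h, rfl⟩
  simp only [key] at h
  refine ComputablePred.computable_of_manyOneReducible
    ⟨Encodable.encode, Computable.encode, fun c => ?_⟩ h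
  have : Nat.Partrec.Code.ofNatCode (Encodable.encode c) = c :=
    Denumerable.ofNat_encode (α := Nat.Partrec.Code) c
  simp only [this]

/-- The simulation is needed only on the invariant `I`: the numerical encoding of a configuration is
faithful only for labels in range. -/
theorem haltsIn_semiconj {α β : Type} {f : α → Option α} {g : β → Option β} (e : α → β)
    (I : α → Prop) (hI : ∀ c c', I c → f c = some c' → I c')
    (h : ∀ c, I c → g (e c) = (f c).map e) : ∀ n c, I c → (HaltsIn g n (e c) ↔ HaltsIn f n c)
  | 0, c, hc => by simp [HaltsIn, h c hc]
  | n + 1, c, hc => by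
    simp only [HaltsIn, h c hc, Option.map_eq_some_iff]
    constructor
    · rintro ⟨_, ⟨c', h1, rfl⟩, h2⟩
      exact ⟨c', h1, (haltsIn_semiconj e I hI h n c' (hI c c' hc h1)).1 h2⟩
    · rintro ⟨c', h1, h2⟩
      exact ⟨_, ⟨c', h1, rfl⟩, (haltsIn_semiconj e I hI h n c' (hI c c' hc h1)).2 h2⟩

/-- The generalized Collatz map that sends `m * d + r`, for `r < m` and `tr r = some (a, b)`, to
`a * d + b`; it is undefined where `tr r = none`. -/
def conwayStep (m : ℕ) (tr : ℕ → Option (ℕ × ℕ)) (x : ℕ) : Option ℕ :=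
  (tr (x % m)).map fun p => p.1 * (x / m) + p.2

/-- The iteration of a generalized Collatz map from `x` ends. -/
def ConwayHalts (m : ℕ) (tr : ℕ → Option (ℕ × ℕ)) (x : ℕ) : Prop :=
  ∃ n, HaltsIn (conwayStep m tr) n x

theorem conwayHalts_of_none {m : ℕ} {tr : ℕ → Option (ℕ × ℕ)} {x : ℕ} (h : tr (x % m) = none) :
    ConwayHalts m tr x :=
  ⟨0, by simp [HaltsIn, conwayStep, h]⟩

theorem conwayHalts_of_some {m : ℕ} {tr : ℕ → Option (ℕ × ℕ)} {x a b : ℕ}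
    (h : tr (x % m) = some (a, b)) (h' : ConwayHalts m tr (a * (x / m) + b)) :
    ConwayHalts m tr x := by
  obtain ⟨n, hn⟩ := h'
  exact ⟨n + 1, _, by simp [conwayStep, h], hn⟩

section Encoding

open Function

/-- The product of the first `N` primes. -/
noncomputable def primeProd (N : ℕ) : ℕ := ∏ i ∈ Finset.range N, Nat.nth Nat.Prime i

/-- Register contents as the exponents of a prime factorization. -/
noncomputable def encodeRegs (N : ℕ) (s : ℕ → ℕ) : ℕ :=
  ∏ i ∈ Finset.range N, Nat.nth Nat.Prime i ^ s i

/-- The coefficients of the generalized Collatz map that simulates the counter program `P`. -/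
noncomputable def conwayOf (P : List Instr) (N : ℕ) (R : ℕ) : Option (ℕ × ℕ) :=
  let L := P.length + 1
  let E := R / L
  match P[R % L]? with
  | none => none
  | some (.inc i q) =>
    some (L * (Nat.nth Nat.Prime i * primeProd N), L * (Nat.nth Nat.Prime i * E) + q)
  | some (.jzdec i q q') =>
    if Nat.nth Nat.Prime i ∣ E then
      some (L * (primeProd N / Nat.nth Nat.Prime i), L * (E / Nat.nth Nat.Prime i) + q)
    else some (L * primeProd N, L * E + q')
  | some (.goto q) => some (L * primeProd N, L * E + q)

theorem encodeRegs_update {N i : ℕ} (hi : i < N) (s : ℕ → ℕ) (k : ℕ) :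
    encodeRegs N (update s i k) =
      Nat.nth Nat.Prime i ^ k * ∏ j ∈ (Finset.range N).erase i, Nat.nth Nat.Prime j ^ s j := by
  rw [encodeRegs, ← Finset.mul_prod_erase _ _ (Finset.mem_range.2 hi), update_self]
  congr 1
  refine Finset.prod_congr rfl fun j hj => ?_
  rw [update_of_ne (Finset.ne_of_mem_erase hj)]

theorem encodeRegs_eq {N i : ℕ} (hi : i < N) (s : ℕ → ℕ) :
    encodeRegs N s =
      Nat.nth Nat.Prime i ^ s i * ∏ j ∈ (Finset.range N).erase i, Nat.nth Nat.Prime j ^ s j := by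
  simpa using encodeRegs_update hi s (s i)

theorem dvd_encodeRegs {N i : ℕ} (hi : i < N) (s : ℕ → ℕ) :
    Nat.nth Nat.Prime i ∣ encodeRegs N s ↔ s i ≠ 0 := by
  rw [encodeRegs_eq hi]
  have hp := Nat.prime_nth_prime i
  constructor
  · intro h h0
    rw [h0, pow_zero, one_mul, hp.prime.dvd_finsetProd_iff] at h
    obtain ⟨j, hj, h⟩ := h
    have := (Nat.prime_dvd_prime_iff_eq hp (Nat.prime_nth_prime j)).1 (hp.dvd_of_dvd_pow h)
    exact Finset.ne_of_mem_erase hj (Nat.nth_injective Nat.infinite_setOfPred_prime this).symm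
  · intro h
    exact (dvd_pow_self _ h).mul_right _

/-- A configuration is the number `L * E + pc`, where `E` has the registers as exponents. Modulo `L
* primeProd N` it reveals `pc` and `E` modulo the product of the primes, hence which primes divide
`E`, that is, which registers are nonzero. Incrementing or decrementing a register multiplies or
divides `E` by its prime, which is affine on each residue class. -/
theorem conwayStep_encode (P : List Instr) {N : ℕ} (hP : ∀ i ∈ P, i.RegLT N) (pc : ℕ)
    (hpc : pc < P.length + 1) (s : ℕ → ℕ) :
    conwayStep ((P.length + 1) * primeProd N) (conwayOf P N)
        ((P.length + 1) * encodeRegs N s + pc) =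
      (progStep P (pc, s)).map fun c => (P.length + 1) * encodeRegs N c.2 + c.1 := by
  set L := P.length + 1 with hL
  set E := encodeRegs N s with hE
  have h1 : (L * E + pc) % (L * primeProd N) % L = pc := by
    rw [Nat.mod_mul_right_mod, Nat.mul_add_mod, Nat.mod_eq_of_lt hpc]
  have hdiv : (L * E + pc) / L = E := by
    rw [Nat.mul_add_div (by omega), Nat.div_eq_of_lt hpc, add_zero]
  have h2 : (L * E + pc) % (L * primeProd N) / L = E % primeProd N := by
    rw [Nat.mod_mul_right_div_self, hdiv]
  have h3 : (L * E + pc) / (L * primeProd N) = E / primeProd N := by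
    rw [← Nat.div_div_eq_div_mul, hdiv]
  have h4 := Nat.div_add_mod E (primeProd N)
  have hdvd : ∀ i < N, Nat.nth Nat.Prime i ∣ primeProd N := fun i hi =>
    Finset.dvd_prod_of_mem _ (Finset.mem_range.2 hi)
  simp only [conwayStep, conwayOf, ← hL, h1, h2, h3, progStep]
  rcases hg : P[pc]? with _ | i
  · simp
  have hi := hP i (List.mem_of_getElem? hg)
  rcases i with ⟨i, q⟩ | ⟨i, q, q'⟩ | q
  · simp only [Instr.RegLT] at hi
    simp only [Option.map_some, Instr.exec]
    rw [encodeRegs_update hi, pow_succ', mul_assoc (Nat.nth _ _) (_ ^ _), ← encodeRegs_eq hi, ← hE]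
    conv_rhs => rw [← h4]
    congr 1
    ring
  · simp only [Instr.RegLT] at hi
    have hiff : Nat.nth Nat.Prime i ∣ E % primeProd N ↔ s i ≠ 0 := by
      rw [Nat.dvd_mod_iff (hdvd i hi), dvd_encodeRegs hi]
    simp only [Option.map_some, Instr.exec, hiff]
    by_cases h0 : s i = 0
    · simp only [h0, ne_eq, not_true_eq_false, if_false, if_true, Option.map_some]
      rw [← hE]
      conv_rhs => rw [← h4]
      congr 1
      ring
    · simp only [h0, ne_eq, not_false_eq_true, if_false, if_true, Option.map_some]
      obtain ⟨k, hk⟩ := Nat.exists_eq_succ_of_ne_zero h0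
      obtain ⟨A, hA⟩ := hdvd i hi
      obtain ⟨B, hB⟩ := hiff.2 h0
      have hpos := (Nat.prime_nth_prime i).pos
      have hEk : E = Nat.nth Nat.Prime i * encodeRegs N (update s i (s i - 1)) := by
        rw [encodeRegs_update hi, hE, encodeRegs_eq hi, hk, Nat.succ_sub_one, pow_succ]
        ring
      have : encodeRegs N (update s i (s i - 1)) = A * (E / primeProd N) + B := by
        refine Nat.eq_of_mul_eq_mul_left hpos ?_
        rw [← hEk, mul_add, ← hB, ← mul_assoc, ← hA, h4]
      rw [this, hB]
      conv_lhs => rw [hA]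
      rw [Nat.mul_div_cancel_left _ hpos, Nat.mul_div_cancel_left _ hpos, ← hA]
      congr 1
      ring
  · simp only [Option.map_some, Instr.exec]
    rw [← hE]
    conv_rhs => rw [← h4]
    congr 1
    ring

end Encoding

/-- There is a generalized Collatz map whose halting problem is undecidable. -/
theorem exists_conwayHalts_undecidable :
    ∃ (m : ℕ) (tr : ℕ → Option (ℕ × ℕ)), 0 < m ∧ ¬ ComputablePred (ConwayHalts m tr) := by
  obtain ⟨c, hc⟩ := exists_cmd_halting_undecidable
  obtain ⟨N₀, hN₀⟩ := exists_regLT (c.code 0)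
  -- The bound is raised by one so that register `0`, which receives the input, is encoded even if
  -- the program never touches it.
  have hN : ∀ i ∈ c.code 0, i.RegLT (N₀ + 1) := by
    intro i hi
    have := hN₀ i hi
    cases i <;> simp only [Instr.RegLT] at this ⊢ <;> omega
  set P := c.code 0 with hP
  set e : ℕ × (ℕ → ℕ) → ℕ := fun c => (P.length + 1) * encodeRegs (N₀ + 1) c.2 + c.1 with he
  -- The starting number is label `0` together with `n` as the exponent of the prime `2`, all other
  -- registers being zero.
  have key : ∀ n, ConwayHalts ((P.length + 1) * primeProd (N₀ + 1)) (conwayOf P (N₀ + 1))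
      ((P.length + 1) * 2 ^ n) ↔ ∃ s', Cmd.Runs c (Function.update 0 0 n) s' := by
    intro n
    rw [← Cmd.haltsIn_code_iff, ConwayHalts]
    refine exists_congr fun k => ?_
    rw [← haltsIn_semiconj (g := conwayStep ((P.length + 1) * primeProd (N₀ + 1))
      (conwayOf P (N₀ + 1))) e (fun c => c.1 < P.length + 1) ?_ ?_ k _ (Nat.succ_pos _)]
    · have : encodeRegs (N₀ + 1) (Function.update 0 0 n) = 2 ^ n := by
        rw [encodeRegs_update (Nat.succ_pos _)]
        simp
      simp [he, this]
    · rintro ⟨pc, s⟩ c' hpc h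
      simp only [progStep, Option.map_eq_some_iff] at h
      obtain ⟨i, hi, rfl⟩ := h
      have := Cmd.code_labelLT c 0 i (List.mem_of_getElem? hi)
      rw [← hP, zero_add] at this
      cases i <;> simp only [Instr.LabelLT] at this
      · exact this
      · simp only [Instr.exec]
        split_ifs
        exacts [this.2, this.1]
      · exact this
    · rintro ⟨pc, s⟩ hpc
      exact conwayStep_encode P hN pc hpc s
  refine ⟨(P.length + 1) * primeProd (N₀ + 1), conwayOf P (N₀ + 1), ?_, fun h => hc ?_⟩
  · exact Nat.mul_pos (Nat.succ_pos _)
      (Finset.prod_pos fun i _ => (Nat.prime_nth_prime i).pos)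
  · refine ComputablePred.computable_of_manyOneReducible
      ⟨fun n => (P.length + 1) * 2 ^ n, ?_, fun n => (key n).symm⟩ h
    have hpow : Primrec fun n : ℕ => 2 ^ n := by
      refine (Primrec.nat_rec₁ 1 ((Primrec.nat_mul.comp (Primrec.const 2)
        (Primrec.snd (α := ℕ) (β := ℕ))).to₂)).of_eq fun n => ?_
      induction n with
      | zero => rfl
      | succ n ih => simp only [pow_succ]; rw [← ih]; simp [mul_comm]
    exact (Primrec.nat_mul.comp (Primrec.const _) hpow).to_comp

/-- `exists_conwayHalts_undecidable` with bounded coefficients. -/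
theorem exists_bounded_conwayHalts_undecidable :
    ∃ (m : ℕ) (tr : ℕ → Option (ℕ × ℕ)) (B : ℕ), 0 < m ∧ m ≤ B ∧
      (∀ r a b, tr r = some (a, b) → r < m ∧ a ≤ B ∧ b ≤ B) ∧
      ¬ ComputablePred (ConwayHalts m tr) := by
  obtain ⟨m, tr, hm, h⟩ := exists_conwayHalts_undecidable
  -- Only residues below `m` are ever looked up, so the coefficients may be dropped from `m` on; the
  -- sum of the finitely many others bounds each of them.
  set f : ℕ → ℕ := fun r => ((tr r).getD (0, 0)).1 + ((tr r).getD (0, 0)).2 with hf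
  refine ⟨m, fun r => if r < m then tr r else none, m + ∑ r ∈ Finset.range m, f r, hm, by omega,
    fun r a b hr => ?_, ?_⟩
  · have hrm : r < m := by by_contra h'; simp [h'] at hr
    replace hr : tr r = some (a, b) := by simpa [hrm] using hr
    have : f r ≤ ∑ r ∈ Finset.range m, f r :=
      Finset.single_le_sum (fun _ _ => Nat.zero_le _) (Finset.mem_range.2 hrm)
    simp only [hf, hr, Option.getD_some] at this
    simp only [hf]
    omega
  · have : conwayStep m (fun r => if r < m then tr r else none) = conwayStep m tr := by
      ext1 x
      simp [conwayStep, Nat.mod_lt _ hm]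
    have : ConwayHalts m (fun r => if r < m then tr r else none) = ConwayHalts m tr := by
      ext1 x
      rw [ConwayHalts, ConwayHalts, this]
    rwa [this]

/-! ### Two-way machines: tape, runs, crossings and renaming of states. -/

section Tape

variable {A : Type} {w : List A} {p : ℕ}

theorem tapeAt_eq_leftEnd : tapeAt w p = some .leftEnd ↔ p = 0 := by
  cases p with
  | zero => simp [tapeAt]
  | succ p =>
    simp only [tapeAt, List.getElem?_cons_succ, Nat.succ_ne_zero, iff_false]
    intro h
    have := List.mem_of_getElem? h
    simp at this

theorem tapeAt_eq_letter {a : A} :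
    tapeAt w p = some (.letter a) ↔ ∃ v u, w = v ++ a :: u ∧ p = v.length + 1 := by
  cases p with
  | zero => simp [tapeAt]
  | succ p =>
    simp only [tapeAt, List.getElem?_cons_succ]
    constructor
    · intro h
      rw [List.getElem?_append] at h
      split_ifs at h with h'
      · rw [List.getElem?_map] at h
        obtain ⟨b, hb, e⟩ := Option.map_eq_some_iff.1 h
        cases e
        have hp : p < w.length := by simpa using h'
        refine ⟨w.take p, w.drop (p + 1), ?_, by simp; omega⟩
        rw [List.getElem?_eq_getElem hp] at hb
        cases hb
        simp
      · have := List.mem_of_getElem? h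
        simp at this
    · rintro ⟨v, u, rfl, e⟩
      obtain rfl : p = v.length := by omega
      simp

theorem tapeAt_eq_rightEnd : tapeAt w p = some .rightEnd ↔ p = w.length + 1 := by
  cases p with
  | zero => simp [tapeAt]
  | succ p =>
    simp only [tapeAt, List.getElem?_cons_succ]
    rw [List.getElem?_append]
    split_ifs with h'
    · have : p < w.length := by simpa using h'
      simp only [List.getElem?_map, Option.map_eq_some_iff, reduceCtorEq, and_false, exists_false,
        false_iff]
      omega
    · simp only [List.length_map, not_lt] at h' ⊢
      rw [List.getElem?_singleton]
      split_ifs with h <;> simp <;> omega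

end Tape

namespace Machine

variable {A Q S T I C : Type} {st : StoreType S T I C}

theorem step_eq_some {M : Machine A Q st} {w : List A} {c c' : Config Q S} :
    M.step w c = some c' ↔ ∃ a t i d, tapeAt w c.pos = some a ∧ st.read c.store = some t ∧
      M.trans c.state a t = some (c'.state, i, d) ∧ d.move c.pos = some c'.pos ∧
      st.apply i c.store = some c'.store := by
  obtain ⟨q, p, s⟩ := c'
  simp only [step, Option.bind_eq_bind, Option.bind_eq_some_iff, Option.pure_def, Option.some.injEq,
    Config.mk.injEq]
  constructor
  · rintro ⟨a, ha, t, ht, ⟨q', i, d⟩, hq, p', hp, s', hs, rfl, rfl, rfl⟩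
    exact ⟨a, t, i, d, ha, ht, hq, hp, hs⟩
  · rintro ⟨a, t, i, d, ha, ht, hq, hp, hs⟩
    exact ⟨a, ha, t, ht, (q, i, d), hq, p, hp, s, hs, rfl, rfl, rfl⟩

/-- A property of the initial configuration that is preserved by steps holds in all computations. -/
theorem IsComputation.invariant {M : Machine A Q st} {w : List A} {c : ℕ → Config Q S} {n : ℕ}
    (h : M.IsComputation w c n) (P : Config Q S → Prop) (h0 : P M.initConfig)
    (hs : ∀ c c', P c → M.step w c = some c' → P c') : ∀ j ≤ n, P (c j)
  | 0, _ => h.1 ▸ h0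
  | j + 1, hj => hs _ _ (h.invariant P h0 hs j (by omega)) (h.2 j (by omega))

/-- The machine can go from one configuration to another. -/
def Reaches (M : Machine A Q st) (w : List A) : Config Q S → Config Q S → Prop :=
  Relation.ReflTransGen fun c c' => M.step w c = some c'

/-- The computation from a configuration is accepting. -/
def AcceptsFrom (M : Machine A Q st) (w : List A) (c : Config Q S) : Prop :=
  ∃ c', M.Reaches w c c' ∧ c'.state ∈ M.final ∧ c'.pos = w.length + 2

theorem AcceptsFrom.head {M : Machine A Q st} {w : List A} {c c' : Config Q S}
    (h' : M.AcceptsFrom w c') (h : M.step w c = some c') : M.AcceptsFrom w c := by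
  obtain ⟨d, h1, h2⟩ := h'
  exact ⟨d, .head h h1, h2⟩

theorem Reaches.exists_seq {M : Machine A Q st} {w : List A} {c d : Config Q S}
    (h : M.Reaches w c d) : ∃ n, ((fun o => o.bind (M.step w))^[n]) (some c) = some d := by
  induction h with
  | refl => exact ⟨0, rfl⟩
  | tail _ hs ih =>
    obtain ⟨n, hn⟩ := ih
    exact ⟨n + 1, by rw [Function.iterate_succ_apply', hn]; exact hs⟩

/-- An accepting computation through a given configuration. -/
theorem exists_isAccepting {M : Machine A Q st} {w : List A} {c : Config Q S}
    (h : M.Reaches w M.initConfig c) (h' : M.AcceptsFrom w c) :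
    ∃ f n, M.IsAccepting w f n ∧ ∃ j ≤ n, f j = c := by
  obtain ⟨d, hd, hfin, hpos⟩ := h'
  obtain ⟨j, hj⟩ := h.exists_seq
  obtain ⟨k, hk⟩ := hd.exists_seq
  set g : ℕ → Option (Config Q S) := fun n => ((fun o => o.bind (M.step w))^[n])
    (some M.initConfig) with hg
  have hgs : ∀ n, g (n + 1) = (g n).bind (M.step w) := fun n => by
    simp only [hg, Function.iterate_succ_apply']
  have hgn : g (j + k) = some d := by
    simp only [hg]
    rw [add_comm, Function.iterate_add_apply, hj, hk]
  have hdef : ∀ n ≤ j + k, (g n).isSome := by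
    refine fun n hn => Nat.decreasingInduction' (P := fun n => (g n).isSome) (fun i _ _ hi => ?_) hn
      (by simp [hgn])
    rw [hgs] at hi
    cases h : g i with
    | none => simp [h] at hi
    | some => rfl
  have hget : ∀ n ≤ j + k, g n = some ((g n).getD c) := fun n hn => by
    obtain ⟨x, hx⟩ := Option.isSome_iff_exists.1 (hdef n hn)
    simp [hx]
  -- The default `c` can appear only after time `j + k`, which no claim concerns.
  refine ⟨fun n => (g n).getD c, j + k, ⟨⟨rfl, fun i hi => ?_⟩, ?_⟩, j, by omega, ?_⟩
  · have h1 := hget i (by omega)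
    have h2 := hget (i + 1) (by omega)
    have h3 : g (i + 1) = M.step w ((g i).getD c) := by
      rw [hgs]
      conv_lhs => rw [h1]
      rfl
    exact h3.symm.trans h2
  · simp only [hgn, Option.getD_some]
    exact ⟨hfin, hpos⟩
  · simp [hg, hj]

/-- The head crosses every boundary at most once in each of finitely many kinds of phases, if it
moves in one direction only in each phase. -/
theorem crossings_le {M : Machine A Q st} {w : List A} {c : ℕ → Config Q S} {n K : ℕ}
    (hc : ∀ j < n, M.step w (c j) = some (c (j + 1))) (kind : Q → Fin K)
    (phase : Fin K → ℕ → ℕ) (right : Fin K → Prop)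
    (hphase : ∀ k k' p p', phase k p = phase k' p' → k = k')
    (hstep : ∀ c c', M.step w c = some c' →
      phase (kind c.state) c.pos ≤ phase (kind c'.state) c'.pos ∧
      (right (kind c.state) → c.pos ≤ c'.pos) ∧ (¬ right (kind c.state) → c'.pos ≤ c.pos))
    (r : ℕ) : crossings c n r ≤ K := by
  have mono : ∀ i j, i ≤ j → j ≤ n →
      phase (kind (c i).state) (c i).pos ≤ phase (kind (c j).state) (c j).pos := by
    intro i j hij
    induction j, hij using Nat.le_induction with
    | base => intro; exact le_rfl
    | succ j hij ih => exact fun hj => (ih (by omega)).trans (hstep _ _ (hc j (by omega))).1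
  have key : ∀ i j, i < j → j < n → kind (c i).state = kind (c j).state →
      (c i).pos = (c j).pos →
      (right (kind (c i).state) → (c (i + 1)).pos ≤ (c j).pos) ∧
      (¬ right (kind (c i).state) → (c j).pos ≤ (c (i + 1)).pos) := by
    intro i j hij hj hk hp
    -- The phase number never decreases and agrees at `i` and `j`, so it is constant in between; as
    -- it determines the kind, the kind is constant too.
    have same : ∀ l, i ≤ l → l ≤ j → kind (c l).state = kind (c i).state := by
      intro l h1 h2
      refine hphase _ _ (c l).pos (c i).pos (le_antisymm ?_ (mono i l h1 (by omega)))
      have := mono l j h2 (by omega)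
      rwa [← hk, ← hp] at this
    have : ∀ l, i + 1 ≤ l → l ≤ j →
        (right (kind (c i).state) → (c (i + 1)).pos ≤ (c l).pos) ∧
        (¬ right (kind (c i).state) → (c l).pos ≤ (c (i + 1)).pos) := by
      intro l hl
      induction l, hl using Nat.le_induction with
      | base => intro; exact ⟨fun _ => le_rfl, fun _ => le_rfl⟩
      | succ l hl ih =>
        intro hlj
        have h1 := ih (by omega)
        have h2 := (hstep _ _ (hc l (by omega))).2
        rw [same l (by omega) (by omega)] at h2
        exact ⟨fun h => (h1.1 h).trans (h2.1 h), fun h => (h2.2 h).trans (h1.2 h)⟩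
    exact this j (by omega) le_rfl
  -- In a fixed direction both crossings start from the same side, so the head would have had to
  -- come back against its direction. Thus each kind contributes at most one crossing.
  have inj : ∀ i j, i < j → j < n → kind (c i).state = kind (c j).state →
      ((c i).pos = r ∧ (c (i + 1)).pos = r + 1 ∨ (c i).pos = r + 1 ∧ (c (i + 1)).pos = r) →
      ((c j).pos = r ∧ (c (j + 1)).pos = r + 1 ∨ (c j).pos = r + 1 ∧ (c (j + 1)).pos = r) →
      False := by
    intro i j hij hj hk hi' hj'
    have h1 := (hstep _ _ (hc i (by omega))).2
    have h2 := (hstep _ _ (hc j (by omega))).2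
    rw [← hk] at h2
    by_cases h : right (kind (c i).state)
    · have h1 := h1.1 h
      have h2 := h2.1 h
      have := (key i j hij hj hk (by omega)).1 h
      omega
    · have h1 := h1.2 h
      have h2 := h2.2 h
      have := (key i j hij hj hk (by omega)).2 h
      omega
  have := Finset.card_le_card_of_injOn (t := (Finset.univ : Finset (Fin K)))
    (s := (Finset.range n).filter fun j => ((c j).pos = r ∧ (c (j + 1)).pos = r + 1) ∨
      ((c j).pos = r + 1 ∧ (c (j + 1)).pos = r))
    (fun j => kind (c j).state) (fun _ _ => Finset.mem_coe.2 (Finset.mem_univ _))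
    (fun i hi j hj hk => by
      simp only [Finset.coe_filter, Finset.mem_range, Set.mem_ofPred_eq] at hi hj
      rcases lt_trichotomy i j with h | h | h
      · exact (inj i j h hj.1 hk hi.2 hj.2).elim
      · exact h
      · exact (inj j i h hi.1 hk.symm hj.2 hi.2).elim)
  simpa [crossings] using this

/-- The machine obtained by renaming the states by `e`, with `d` in the other direction. -/
def rename {Q' : Type} (M : Machine A Q st) (e : Q → Q') (d : Q' → Q) : Machine A Q' st where
  start := e M.start
  final := d ⁻¹' M.final
  trans q a t := (M.trans (d q) a t).map fun x => (e x.1, x.2)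

section Rename

variable {Q' : Type} {M : Machine A Q st} {e : Q → Q'} {d : Q' → Q} {F : Set Q} {w : List A} {n : ℕ}

/-- Rename the state of a configuration. -/
def _root_.TwoWay.Config.mapState (f : Q → Q') (c : Config Q S) : Config Q' S :=
  ⟨f c.state, c.pos, c.store⟩

theorem rename_step_iff (c c' : Config Q' S) : (M.rename e d).step w c = some c' ↔
    ∃ q, M.step w (c.mapState d) = some ⟨q, c'.pos, c'.store⟩ ∧ e q = c'.state := by
  simp only [step_eq_some, rename, Config.mapState, Option.map_eq_some_iff, Prod.exists]
  constructor
  · rintro ⟨a, t, i, x, h1, h2, ⟨q, i', x', h3, h4⟩, h5, h6⟩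
    simp only [Prod.mk.injEq] at h4
    obtain ⟨h4, rfl, rfl⟩ := h4
    exact ⟨q, ⟨a, t, _, _, h1, h2, h3, h5, h6⟩, h4⟩
  · rintro ⟨q, ⟨a, t, i, x, h1, h2, h3, h4, h5⟩, h6⟩
    exact ⟨a, t, i, x, h1, h2, ⟨q, i, x, h3, by rw [h6]⟩, h4, h5⟩

/-- Since `d` takes all its values in `F`, and `e` is inverted by `d` there, every computation of
the renamed machine comes from the original one. This transfers properties of all computations, such
as bounds on crossings. -/
theorem IsComputation.of_rename (hd : ∀ q, d q ∈ F) (hde : ∀ q ∈ F, d (e q) = q)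
    (h0 : M.start ∈ F) (hF : ∀ q ∈ F, ∀ a t q' i x, M.trans q a t = some (q', i, x) → q' ∈ F)
    {c : ℕ → Config Q' S} (h : (M.rename e d).IsComputation w c n) :
    M.IsComputation w (fun j => (c j).mapState d) n := by
  refine ⟨?_, fun j hj => ?_⟩
  · simp only [h.1, initConfig, Config.mapState, rename, hde _ h0]
  · obtain ⟨q, h1, h2⟩ := (rename_step_iff _ _).1 (h.2 j hj)
    simp only [h1]
    obtain ⟨a, t, i, x, -, -, h3, -⟩ := step_eq_some.1 h1
    simp only [Config.mapState, ← h2, hde q (hF _ (hd _) _ _ _ _ _ h3)]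

theorem IsComputation.rename (hde : ∀ q ∈ F, d (e q) = q)
    (h0 : M.start ∈ F) (hF : ∀ q ∈ F, ∀ a t q' i x, M.trans q a t = some (q', i, x) → q' ∈ F)
    {c : ℕ → Config Q S} (h : M.IsComputation w c n) :
    (M.rename e d).IsComputation w (fun j => (c j).mapState e) n ∧ ∀ j ≤ n, (c j).state ∈ F := by
  have hmem := h.invariant (fun c => c.state ∈ F) h0 (fun c c' hc hs => by
    obtain ⟨a, t, i, x, -, -, h3, -⟩ := step_eq_some.1 hs
    exact hF _ hc _ _ _ _ _ h3)
  refine ⟨⟨?_, fun j hj => ?_⟩, hmem⟩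
  · simp only [h.1, initConfig, Config.mapState, Machine.rename]
  · refine (rename_step_iff _ _).2 ⟨(c (j + 1)).state, ?_, rfl⟩
    have := h.2 j hj
    simpa [Config.mapState, hde _ (hmem j hj.le)] using this

end Rename

/-- A machine whose reachable states are among finitely many is equivalent to one with states
`Fin k`. -/
theorem exists_fin_machine (M : Machine A Q st) {F : Set Q} (hfin : F.Finite) (h0 : M.start ∈ F)
    (hF : ∀ q ∈ F, ∀ a t q' i x, M.trans q a t = some (q', i, x) → q' ∈ F) :
    ∃ (k : ℕ) (M' : Machine A (Fin k) st) (e : Q → Fin k) (d : Fin k → Q),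
      (∀ w c n, M'.IsComputation w c n → M.IsComputation w (fun j => (c j).mapState d) n) ∧
      (∀ w c n, M'.IsAccepting w c n → M.IsAccepting w (fun j => (c j).mapState d) n) ∧
      ∀ q ∈ F, ∀ u : List C, Sum.inl (e q) :: u.map Sum.inr ∈ M'.storeLanguage ↔
        Sum.inl q :: u.map Sum.inr ∈ M.storeLanguage := by
  classical
  have : Finite F := hfin
  obtain ⟨k, ⟨φ⟩⟩ := Finite.exists_equiv_fin F
  -- Off the closed set `F` the value of `e` is arbitrary; the start state serves as a default.
  set e : Q → Fin k := fun q => if h : q ∈ F then φ ⟨q, h⟩ else φ ⟨M.start, h0⟩ with he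
  set d : Fin k → Q := fun i => (φ.symm i : Q) with hd'
  have hd : ∀ q, d q ∈ F := fun q => (φ.symm q).2
  have hde : ∀ q ∈ F, d (e q) = q := fun q hq => by simp [he, hd', hq]
  have comp : ∀ w c n, (M.rename e d).IsComputation w c n →
      M.IsComputation w (fun j => (c j).mapState d) n :=
    fun w c n h => h.of_rename hd hde h0 hF
  have acc : ∀ w c n, (M.rename e d).IsAccepting w c n →
      M.IsAccepting w (fun j => (c j).mapState d) n :=
    fun w c n h => ⟨comp w c n h.1, h.2⟩
  refine ⟨k, M.rename e d, e, d, comp, acc, fun q hq u => ⟨?_, ?_⟩⟩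
  · rintro ⟨w, c, n, h, j, hj, hu⟩
    refine ⟨w, _, n, acc w c n h, j, hj, ?_⟩
    simp only [List.cons.injEq, Sum.inl.injEq, Config.mapState,
      List.map_inj_right fun _ _ => Sum.inr.inj] at hu ⊢
    exact ⟨by rw [← hu.1, hde q hq], hu.2⟩
  · rintro ⟨w, c, n, h, j, hj, hu⟩
    obtain ⟨h1, h2⟩ := h.1.rename (e := e) (d := d) hde h0 hF
    refine ⟨w, _, n, ⟨h1, ?_, h.2.2⟩, j, hj, ?_⟩
    · change d (e _) ∈ M.final
      rw [hde _ (h2 n le_rfl)]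
      exact h.2.1
    · simp only [List.cons.injEq, Sum.inl.injEq, Config.mapState,
        List.map_inj_right fun _ _ => Sum.inr.inj] at hu ⊢
      exact ⟨congrArg e hu.1, hu.2⟩

end Machine

theorem primrec_append_replicate {α : Type} [Primcodable α] (u : List α) (a : α) :
    Primrec fun n : ℕ => u ++ List.replicate n a := by
  refine Primrec.list_append.comp (Primrec.const u) ((Primrec.nat_rec₁ []
    ((Primrec.list_cons.comp (Primrec.const a) (Primrec.snd (α := ℕ))).to₂)).of_eq fun n => ?_)
  induction n with
  | zero => rfl
  | succ n ih => simp only [List.replicate_succ]; rw [← ih]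

/-- A language is not recursive if an undecidable set of numbers can be read off from its words of
the form `u aⁿ`. -/
theorem not_isRecursive {α : Type} [Primcodable α] {L : Language α} {p : ℕ → Prop}
    (hp : ¬ ComputablePred p) (u : List α) (a : α) (h : ∀ n, u ++ List.replicate n a ∈ L ↔ p n) :
    ¬ IsRecursive L := fun hL =>
  hp (ComputablePred.computable_of_manyOneReducible
    ⟨_, (primrec_append_replicate u a).to_comp, fun n => (h n).symm⟩ hL)

theorem takeWhile_replicate_append {α : Type} {p : α → Bool} {a : α} (n : ℕ) {u : List α}
    (ha : p a = true) (hu : ∀ b ∈ u.head?, p b = false) :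
    ((List.replicate n a ++ u).takeWhile p).length = n := by
  rw [List.takeWhile_append_of_pos (fun b hb => List.eq_of_mem_replicate hb ▸ ha)]
  cases u with
  | nil => simp
  | cons b u => simp [hu b rfl]

theorem exists_tapeAt {A : Type} {w : List A} {p : ℕ} (hp : p ≤ w.length + 1) :
    ∃ a, tapeAt w p = some a := by
  have : p < (TapeSym.leftEnd :: (w.map TapeSym.letter ++ [TapeSym.rightEnd])).length := by
    simp; omega
  exact ⟨_, List.getElem?_eq_getElem this⟩

theorem move_right_eq {p p' : ℕ} : Dir.right.move p = some p' ↔ p' = p + 1 := by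
  simp [Dir.move, eq_comm]

theorem move_stay_eq {p p' : ℕ} : Dir.stay.move p = some p' ↔ p' = p := by
  simp [Dir.move, eq_comm]

theorem move_left_eq {p p' : ℕ} : Dir.left.move p = some p' ↔ p = p' + 1 := by
  cases p <;> simp [Dir.move]

theorem counter_keep_eq {z z' : ℕ} : counterStore.apply .keep z = some z' ↔ z' = z := by
  simp [counterStore, eq_comm]

theorem counter_inc_eq {z z' : ℕ} : counterStore.apply .inc z = some z' ↔ z' = z + 1 := by
  simp [counterStore, eq_comm]

theorem counter_dec_eq {z z' : ℕ} : counterStore.apply .dec z = some z' ↔ z = z' + 1 := by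
  cases z <;> simp [counterStore]

theorem counter_read_eq {z : ℕ} {t : Bool} : counterStore.read z = some t ↔ t = decide (z ≠ 0) := by
  simp only [counterStore, Option.some.injEq]
  exact eq_comm

/-! ### A bounded language: the head position as a second counter. -/

namespace Bounded

/-- The states of a machine that uses its head position as a second counter. -/
inductive State where
  | init
  | load
  | mark
  | home
  | down (r : ℕ)
  | up (a b i : ℕ)
  | add (i : ℕ)
  | acc
  | fin

/-- On input `0ⁿ 1ˡ` the machine counts to `n`, and then iterates the generalized Collatz map given
by `m` and `tr` from `n` on: it divides the counter by `m`, with the quotient in the head position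
and the remainder in the state, and multiplies the head position back into the counter. -/
def trans (m : ℕ) (tr : ℕ → Option (ℕ × ℕ)) :
    State → TapeSym (Fin 2) → Bool → Option (State × CounterInstr × Dir)
  | .init, .leftEnd, _ => some (.load, .keep, .right)
  | .load, .letter a, _ =>
    if a = 0 then some (.load, .inc, .right) else some (.mark, .keep, .stay)
  | .load, .rightEnd, _ => some (.mark, .keep, .stay)
  | .mark, .letter a, _ => if a = 0 then none else some (.mark, .keep, .right)
  | .mark, .rightEnd, _ => some (.home, .keep, .stay)
  | .home, .leftEnd, _ => some (.down 0, .keep, .stay)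
  | .home, .letter _, _ => some (.home, .keep, .left)
  | .home, .rightEnd, _ => some (.home, .keep, .left)
  -- If the tape is too short for the quotient, the head falls off at the right in a state that is
  -- not final, so the input is rejected.
  | .down r, _, true =>
    if r + 1 < m then some (.down (r + 1), .dec, .stay) else some (.down 0, .dec, .right)
  | .down r, _, false =>
    match tr r with
    | none => some (.acc, .keep, .stay)
    | some (a, b) => some (.up a b 0, .keep, .stay)
  | .up a b (i + 1), _, _ => some (.up a b i, .inc, .stay)
  | .up _ b 0, .leftEnd, _ => some (.add b, .keep, .stay)
  | .up a b 0, .letter _, _ => some (.up a b a, .keep, .left)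
  | .up a b 0, .rightEnd, _ => some (.up a b a, .keep, .left)
  | .add (i + 1), _, _ => some (.add i, .inc, .stay)
  | .add 0, _, _ => some (.down 0, .keep, .stay)
  | .acc, .rightEnd, _ => some (.fin, .keep, .right)
  | .acc, .leftEnd, _ => some (.acc, .keep, .right)
  | .acc, .letter _, _ => some (.acc, .keep, .right)
  | _, _, _ => none

/-- The machine with transitions `trans m tr`. -/
def machine (m : ℕ) (tr : ℕ → Option (ℕ × ℕ)) : CounterMachine (Fin 2) State where
  start := .init
  final := {.fin}
  trans := trans m tr

/-- The number of leading zeros. -/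
def lead (w : List (Fin 2)) : ℕ := (w.takeWhile (· = 0)).length

/-- The word has the form `0ⁿ 1ˡ`. -/
def WellFormed (w : List (Fin 2)) : Prop := ∃ n l, w = List.replicate n 0 ++ List.replicate l 1

theorem lead_eq (n l : ℕ) : lead (List.replicate n 0 ++ List.replicate l 1) = n :=
  takeWhile_replicate_append n (by simp) (by cases l <;> simp [List.replicate_succ])

/-- An invariant of the computations on `w`. -/
def Inv (m : ℕ) (tr : ℕ → Option (ℕ × ℕ)) (w : List (Fin 2)) (c : Config State ℕ) : Prop :=
  let p := c.pos
  let z := c.store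
  let H := ConwayHalts m tr
  match c.state with
  | .init => p = 0 ∧ z = 0
  | .load => p = z + 1 ∧ ∃ u, w = List.replicate z 0 ++ u
  | .mark => z = lead w ∧ ∃ l u, w = List.replicate z 0 ++ List.replicate l 1 ++ u ∧ p = z + l + 1
  | .home => z = lead w ∧ WellFormed w
  | .down r => WellFormed w ∧ r < m ∧ (H (m * p + r + z) → H (lead w))
  | .up a b i => WellFormed w ∧ (H (a * p + i + b + z) → H (lead w))
  | .add i => WellFormed w ∧ p = 0 ∧ (H (i + z) → H (lead w))
  | .acc | .fin => WellFormed w ∧ H (lead w)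

/-- Soundness. The number represented is `m * p + r + z` during division and `a * p + i + b + z`
during multiplication; both are unchanged within their phases. The switch between them is one
application of the map, and it is used backwards: if the iteration ends from the image, it ends from
the argument. During `mark` the counter stays equal to `lead w` while the tail of ones is checked.
-/
theorem inv_step {m : ℕ} (hm : 0 < m) {tr : ℕ → Option (ℕ × ℕ)} {w : List (Fin 2)}
    (c c' : Config State ℕ) (hI : Inv m tr w c) (h : (machine m tr).step w c = some c') :
    Inv m tr w c' := by
  obtain ⟨a, t, i, d, h1, h2, h3, h4, h5⟩ := Machine.step_eq_some.1 h
  obtain ⟨q, p, z⟩ := c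
  obtain ⟨q', p', z'⟩ := c'
  simp only [machine, counter_read_eq] at h1 h2 h3 h4 h5
  cases q with
  | init =>
    cases a <;> simp only [trans, Option.some.injEq, Prod.mk.injEq, reduceCtorEq] at h3
    obtain ⟨rfl, rfl, rfl⟩ := h3
    rw [move_right_eq] at h4
    rw [counter_keep_eq] at h5
    obtain ⟨hp, hz⟩ := hI
    simp only at hp hz
    subst hp hz h4 h5
    exact ⟨rfl, w, rfl⟩
  | load =>
    obtain ⟨hp, u, hw⟩ := hI
    simp only at hp hw
    cases a with
    | leftEnd => simp [trans] at h3
    | letter a =>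
      obtain ⟨v, u', hw', hp'⟩ := tapeAt_eq_letter.1 h1
      obtain ⟨rfl, rfl⟩ : List.replicate z 0 = v ∧ u = a :: u' :=
        List.append_inj (hw.symm.trans hw') (by simp; omega)
      simp only [trans] at h3
      split_ifs at h3 with ha <;> cases h3
      · rw [move_right_eq] at h4
        rw [counter_inc_eq] at h5
        subst h4 h5 ha
        exact ⟨by simp only; omega, u', by rw [hw, List.replicate_succ']; simp⟩
      · rw [move_stay_eq] at h4
        rw [counter_keep_eq] at h5
        subst h4 h5
        refine ⟨?_, 0, a :: u', by simp [hw], by simp only; omega⟩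
        simp only
        rw [hw, lead, takeWhile_replicate_append _ (by simp) (by simp [ha])]
    | rightEnd =>
      rw [tapeAt_eq_rightEnd] at h1
      cases h3
      rw [move_stay_eq] at h4
      rw [counter_keep_eq] at h5
      subst h4 h5
      have hl := congrArg List.length hw
      simp only [List.length_append, List.length_replicate] at hl
      obtain rfl : u = [] := List.eq_nil_of_length_eq_zero (by omega)
      refine ⟨?_, 0, [], by simp [hw], by simp only; omega⟩
      simp only
      conv_rhs => rw [hw]
      exact (lead_eq _ 0).symm
  | mark =>
    obtain ⟨hz, l, u, hw, hp⟩ := hI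
    simp only at hz hp hw
    cases a with
    | leftEnd => simp [trans] at h3
    | letter a =>
      obtain ⟨v, u', hw', hp'⟩ := tapeAt_eq_letter.1 h1
      obtain ⟨rfl, rfl⟩ : _ = v ∧ u = a :: u' :=
        List.append_inj (hw.symm.trans hw') (by simp; omega)
      simp only [trans] at h3
      split_ifs at h3 with ha
      cases h3
      rw [move_right_eq] at h4
      rw [counter_keep_eq] at h5
      subst h4 h5
      obtain rfl : a = 1 := by omega
      exact ⟨hz, l + 1, u', by simp only; rw [hw, List.replicate_succ']; simp,
        by simp only; omega⟩
    | rightEnd =>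
      rw [tapeAt_eq_rightEnd] at h1
      cases h3
      rw [counter_keep_eq] at h5
      subst h5
      have hl := congrArg List.length hw
      simp only [List.length_append, List.length_replicate] at hl
      obtain rfl : u = [] := List.eq_nil_of_length_eq_zero (by omega)
      exact ⟨hz, z', l, by simpa using hw⟩
  | home =>
    obtain ⟨hz, hw⟩ := hI
    simp only at hz
    cases a <;> cases h3 <;> rw [counter_keep_eq] at h5 <;> subst h5
    · rw [tapeAt_eq_leftEnd] at h1
      rw [move_stay_eq] at h4
      subst h1 h4
      refine ⟨hw, hm, ?_⟩
      simp [hz]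
    · exact ⟨hz, hw⟩
    · exact ⟨hz, hw⟩
  | down r =>
    obtain ⟨hw, hr, hH⟩ := hI
    simp only at hH
    by_cases hz : z = 0
    · obtain rfl : t = false := by simp [h2, hz]
      subst hz
      have hmod : (m * p + r + 0) % m = r := by
        rw [add_zero, Nat.mul_add_mod, Nat.mod_eq_of_lt hr]
      have hdiv : (m * p + r + 0) / m = p := by
        rw [add_zero, Nat.mul_add_div hm, Nat.div_eq_of_lt hr, add_zero]
      simp only [trans] at h3
      split at h3 <;> rename_i htr <;> cases h3 <;> rw [counter_keep_eq] at h5 <;>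
        rw [move_stay_eq] at h4 <;> subst h4 h5
      · exact ⟨hw, hH (conwayHalts_of_none (by rwa [hmod]))⟩
      · refine ⟨hw, fun h => hH (conwayHalts_of_some (by rwa [hmod]) ?_)⟩
        rw [hdiv]
        simpa using h
    · obtain rfl : t = true := by simp [h2, hz]
      simp only [trans] at h3
      split_ifs at h3 with hr' <;> cases h3 <;> rw [counter_dec_eq] at h5 <;> subst h5
      · rw [move_stay_eq] at h4
        subst h4
        refine ⟨hw, hr', fun h => hH ?_⟩
        convert h using 1
        ring
      · rw [move_right_eq] at h4
        subst h4
        refine ⟨hw, hm, fun h => hH ?_⟩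
        convert h using 1
        obtain rfl : m = r + 1 := by omega
        simp only
        ring
  | up a' b i' =>
    obtain ⟨hw, hH⟩ := hI
    simp only at hH
    cases i' with
    | zero =>
      cases a with
      | leftEnd =>
        cases h3
        rw [tapeAt_eq_leftEnd] at h1
        rw [counter_keep_eq] at h5
        subst h1 h5
        rw [move_stay_eq] at h4
        subst h4
        exact ⟨hw, rfl, by simpa using hH⟩
      | _ =>
        cases h3
        rw [counter_keep_eq] at h5
        rw [move_left_eq] at h4
        subst h4 h5
        refine ⟨hw, fun h => hH ?_⟩
        convert h using 1
        simp only
        ring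
    | succ i' =>
      cases h3
      rw [counter_inc_eq] at h5
      rw [move_stay_eq] at h4
      subst h4 h5
      refine ⟨hw, fun h => hH ?_⟩
      convert h using 1
      simp only
      ring
  | add i' =>
    obtain ⟨hw, hp, hH⟩ := hI
    simp only at hp hH
    cases i' with
    | zero =>
      cases h3
      rw [counter_keep_eq] at h5
      rw [move_stay_eq] at h4
      subst hp h4 h5
      exact ⟨hw, hm, by simpa using hH⟩
    | succ i' =>
      cases h3
      rw [counter_inc_eq] at h5
      rw [move_stay_eq] at h4
      subst hp h4 h5
      refine ⟨hw, rfl, fun h => hH ?_⟩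
      convert h using 1
      simp only
      ring
  | acc =>
    cases a <;> cases h3 <;> exact hI
  | fin => cases a <;> cases h3

section Accepts

variable {m : ℕ} {tr : ℕ → Option (ℕ × ℕ)} {w : List (Fin 2)}

theorem step_intro {q q' : State} {p p' z z' : ℕ} {a : TapeSym (Fin 2)} {i : CounterInstr}
    {d : Dir} (h1 : tapeAt w p = some a) (h2 : trans m tr q a (decide (z ≠ 0)) = some (q', i, d))
    (h3 : d.move p = some p') (h4 : counterStore.apply i z = some z') :
    (machine m tr).step w ⟨q, p, z⟩ = some ⟨q', p', z'⟩ :=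
  Machine.step_eq_some.2 ⟨a, _, i, d, h1, rfl, h2, h3, h4⟩

theorem acceptsFrom_acc {p : ℕ} (hp : p ≤ w.length + 1) (z : ℕ) :
    (machine m tr).AcceptsFrom w ⟨.acc, p, z⟩ := by
  refine Nat.decreasingInduction' (P := fun p => (machine m tr).AcceptsFrom w ⟨.acc, p, z⟩)
    (fun p hp _ ih => ?_) hp ?_
  · obtain ⟨a, ha⟩ := exists_tapeAt hp.le
    cases a with
    | rightEnd => rw [tapeAt_eq_rightEnd] at ha; omega
    | _ => exact ih.head (step_intro ha rfl rfl rfl)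
  · exact ⟨⟨.fin, w.length + 2, z⟩,
      .single (step_intro (tapeAt_eq_rightEnd.2 rfl) rfl rfl rfl), rfl, rfl⟩

theorem acceptsFrom_add {i z : ℕ} (h : (machine m tr).AcceptsFrom w ⟨.down 0, 0, z + i⟩) :
    (machine m tr).AcceptsFrom w ⟨.add i, 0, z⟩ := by
  induction i generalizing z with
  | zero => exact h.head (step_intro (tapeAt_eq_leftEnd.2 rfl) rfl rfl rfl)
  | succ i ih =>
    refine (ih ?_).head (step_intro (z' := z + 1) (tapeAt_eq_leftEnd.2 rfl) rfl rfl rfl)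
    convert h using 2
    omega

theorem acceptsFrom_up {a b p : ℕ} (hp : p ≤ w.length + 1) {i z : ℕ}
    (h : (machine m tr).AcceptsFrom w ⟨.add b, 0, z + i + a * p⟩) :
    (machine m tr).AcceptsFrom w ⟨.up a b i, p, z⟩ := by
  induction p generalizing i z with
  | zero =>
    induction i generalizing z with
    | zero =>
      refine Machine.AcceptsFrom.head ?_ (step_intro (tapeAt_eq_leftEnd.2 rfl) rfl rfl rfl)
      simpa using h
    | succ i ih =>
      refine (ih ?_).head (step_intro (z' := z + 1) (tapeAt_eq_leftEnd.2 rfl) rfl rfl rfl)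
      convert h using 2
      omega
  | succ p ihp =>
    obtain ⟨s, hs⟩ := exists_tapeAt hp
    induction i generalizing z with
    | zero =>
      have := ihp (by omega) (i := a) (z := z) (by convert h using 2; ring)
      cases s with
      | leftEnd => rw [tapeAt_eq_leftEnd] at hs; omega
      | _ => exact this.head (step_intro hs rfl rfl rfl)
    | succ i ih =>
      refine (ih ?_).head (step_intro (z' := z + 1) hs (by cases s <;> rfl) rfl rfl)
      convert h using 2
      omega

/-- The only obstacle to completing a division is space: the final head position, where the quotient
has been added, must lie on the tape. -/
theorem acceptsFrom_down {z r p : ℕ} (hr : r < m) (hp : p + (r + z) / m ≤ w.length + 1)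
    (h : (machine m tr).AcceptsFrom w ⟨.down ((r + z) % m), p + (r + z) / m, 0⟩) :
    (machine m tr).AcceptsFrom w ⟨.down r, p, z⟩ := by
  induction z generalizing r p with
  | zero => simpa [Nat.mod_eq_of_lt hr, Nat.div_eq_of_lt hr] using h
  | succ z ih =>
    obtain ⟨a, ha⟩ := exists_tapeAt (w := w) (p := p)
      ((Nat.le_add_right _ _).trans hp)
    by_cases hr' : r + 1 < m
    · have e : r + (z + 1) = r + 1 + z := by omega
      rw [e] at h hp
      exact(ih hr' hp h).head
        (step_intro (i := .dec) (d := .stay) ha (by simp [trans, hr']) rfl rfl)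
    · have e : r + (z + 1) = 0 + z + m := by omega
      rw [e, Nat.add_div_right _ (by omega)] at hp
      rw [e, Nat.add_div_right _ (by omega), Nat.add_mod_right] at h
      refine (ih (r := 0) (p := p + 1) (by omega) (by omega) ?_).head
        (step_intro (i := .dec) (d := .right) ha (by simp [trans, hr']) rfl rfl)
      convert h using 2
      omega

/-- A terminating iteration visits finitely many numbers, and a tape at least as long as the largest
of them leaves room for all quotients. -/
theorem exists_acceptsFrom_of_haltsIn (hm : 0 < m) {k x : ℕ} (h : HaltsIn (conwayStep m tr) k x) :
    ∃ B, ∀ w : List (Fin 2), B ≤ w.length → (machine m tr).AcceptsFrom w ⟨.down 0, 0, x⟩ := by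
  induction k generalizing x with
  | zero =>
    refine ⟨x, fun w hw => ?_⟩
    have hx : x / m ≤ w.length + 1 := (Nat.div_le_self _ _).trans (by omega)
    obtain ⟨a, ha⟩ := exists_tapeAt hx
    refine acceptsFrom_down hm (by simpa using hx) ?_
    simp only [zero_add]
    have htr : tr (x % m) = none := by simpa [HaltsIn, conwayStep] using h
    exact (acceptsFrom_acc hx 0).head
      (step_intro (i := .keep) (d := .stay) ha (by simp [trans, htr]) rfl rfl)
  | succ k ih =>
    obtain ⟨y, hy, h⟩ := h
    obtain ⟨B, hB⟩ := ih h
    refine ⟨max x B, fun w hw => ?_⟩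
    have hx : x / m ≤ w.length + 1 := (Nat.div_le_self _ _).trans (by omega)
    obtain ⟨s, hs⟩ := exists_tapeAt hx
    refine acceptsFrom_down hm (by simpa using hx) ?_
    simp only [zero_add]
    obtain ⟨⟨a, b⟩, htr, rfl⟩ : ∃ ab, tr (x % m) = some ab ∧ ab.1 * (x / m) + ab.2 = y := by
      simpa [conwayStep] using hy
    refine (acceptsFrom_up hx (acceptsFrom_add ?_)).head
      (step_intro (q' := .up a b 0) (i := .keep) (d := .stay) hs
        (by simp [trans, htr]) rfl rfl)
    simpa using hB w (by omega)

theorem acceptsFrom_home {p z : ℕ} (hp : p ≤ w.length + 1)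
    (h : (machine m tr).AcceptsFrom w ⟨.down 0, 0, z⟩) :
    (machine m tr).AcceptsFrom w ⟨.home, p, z⟩ := by
  induction p with
  | zero => exact h.head (step_intro (tapeAt_eq_leftEnd.2 rfl) rfl rfl rfl)
  | succ p ih =>
    obtain ⟨a, ha⟩ := exists_tapeAt hp
    cases a with
    | leftEnd => rw [tapeAt_eq_leftEnd] at ha; omega
    | _ => exact (ih (by omega)).head (step_intro ha rfl rfl rfl)

theorem acceptsFrom_mark {n l : ℕ} (hw : w = List.replicate n 0 ++ List.replicate l 1)
    (h : (machine m tr).AcceptsFrom w ⟨.down 0, 0, n⟩) :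
    (machine m tr).AcceptsFrom w ⟨.mark, n + 1, n⟩ := by
  have hl : w.length = n + l := by simp [hw]
  refine Nat.decreasingInduction' (P := fun k => (machine m tr).AcceptsFrom w ⟨.mark, n + k + 1, n⟩)
    (fun k hk _ ih => ?_) (Nat.zero_le l) ?_
  · refine ih.head (step_intro (i := .keep) (d := .right) (a := .letter 1)
      (tapeAt_eq_letter.2 ⟨List.replicate n 0 ++ List.replicate k 1,
      List.replicate (l - k - 1) 1, ?_, by simp⟩) rfl rfl rfl)
    rw [hw, List.append_assoc, ← List.replicate_succ, ← List.replicate_add]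
    congr 2
    omega
  · exact (acceptsFrom_home (by omega) h).head
      (step_intro (tapeAt_eq_rightEnd.2 (by omega)) rfl rfl rfl)

theorem reaches_mark {n l : ℕ} (hw : w = List.replicate n 0 ++ List.replicate l 1) :
    (machine m tr).Reaches w (machine m tr).initConfig ⟨.mark, n + 1, n⟩ := by
  have hl : w.length = n + l := by simp [hw]
  have load : ∀ k ≤ n, (machine m tr).Reaches w (machine m tr).initConfig ⟨.load, k + 1, k⟩ := by
    intro k
    induction k with
    | zero => exact fun _ => .single (step_intro (tapeAt_eq_leftEnd.2 rfl) rfl rfl rfl)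
    | succ k ih =>
      refine fun hk => (ih (by omega)).tail (step_intro (i := .inc) (d := .right)
        (a := .letter 0) (tapeAt_eq_letter.2
        ⟨List.replicate k 0, List.replicate (n - k - 1) 0 ++ List.replicate l 1, ?_, by simp⟩)
        rfl rfl rfl)
      rw [hw, ← List.cons_append, ← List.append_assoc, ← List.replicate_succ, ← List.replicate_add]
      congr 2
      omega
  refine (load n le_rfl).tail ?_
  cases l with
  | zero => exact step_intro (tapeAt_eq_rightEnd.2 (by omega)) rfl rfl rfl
  | succ l =>
    exact step_intro (tapeAt_eq_letter.2 ⟨_, _, hw, by simp⟩) rfl rfl rfl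

end Accepts

/-- In state `mark` the counter equals `lead w`, so the store word fixes the starting number, and
acceptance certifies halting from it. For the converse, the tail of ones is chosen long enough. -/
theorem mark_mem_storeLanguage {m : ℕ} (hm : 0 < m) (tr : ℕ → Option (ℕ × ℕ)) (n : ℕ) :
    Sum.inl State.mark :: (List.replicate n ()).map Sum.inr ∈ (machine m tr).storeLanguage ↔
      ConwayHalts m tr n := by
  constructor
  · rintro ⟨w, c, N, h, j, hj, hu⟩
    have inv := h.1.invariant (Inv m tr w) ⟨rfl, rfl⟩ (inv_step hm)
    simp only [List.cons.injEq, Sum.inl.injEq, List.map_inj_right fun _ _ => Sum.inr.inj] at hu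
    have hz : n = (c j).store := by simpa [counterStore] using congrArg List.length hu.2
    have hmark := inv j hj
    simp only [Inv, ← hu.1] at hmark
    have hfin := inv N le_rfl
    have hstate : (c N).state = .fin := h.2.1
    simp only [Inv, hstate] at hfin
    rw [hz, hmark.1]
    exact hfin.2
  · rintro ⟨k, hk⟩
    obtain ⟨B, hB⟩ := exists_acceptsFrom_of_haltsIn hm hk
    obtain ⟨c, N, h, j, hj, hc⟩ := Machine.exists_isAccepting (reaches_mark (l := B) rfl)
      (acceptsFrom_mark (n := n) rfl (hB _ (by simp)))
    exact ⟨_, c, N, h, j, hj, by rw [hc]; rfl⟩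

theorem wellFormed_of_isAccepting {m : ℕ} (hm : 0 < m) {tr : ℕ → Option (ℕ × ℕ)} {w : List (Fin 2)}
    {c : ℕ → Config State ℕ} {n : ℕ} (h : (machine m tr).IsAccepting w c n) : WellFormed w := by
  have hfin := h.1.invariant (Inv m tr w) ⟨rfl, rfl⟩ (inv_step hm) n le_rfl
  have hstate : (c n).state = .fin := h.2.1
  simp only [Inv, hstate] at hfin
  exact hfin.1

theorem isBounded_of_wellFormed {L : Language (Fin 2)} (h : ∀ w ∈ L, WellFormed w) :
    IsBounded L := by
  have pow : ∀ (a : Fin 2) n, List.replicate n a ∈ KStar.kstar ({[a]} : Language (Fin 2)) := by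
    intro a n
    rw [Language.mem_kstar]
    refine ⟨List.replicate n [a], by simp, ?_⟩
    intro y hy
    exact List.eq_of_mem_replicate hy
  refine ⟨[[0], [1]], by simp, fun w hw => ?_⟩
  obtain ⟨n, l, rfl⟩ := h w hw
  simp only [List.map_cons, List.map_nil, List.prod_cons, List.prod_nil, mul_one]
  exact Language.append_mem_mul (pow 0 n) (pow 1 l)

/-- The tag and the parameters of a state. -/
def State.code : State → ℕ × ℕ × ℕ × ℕ
  | .init => (0, 0, 0, 0)
  | .load => (1, 0, 0, 0)
  | .mark => (2, 0, 0, 0)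
  | .home => (3, 0, 0, 0)
  | .down r => (4, r, 0, 0)
  | .up a b i => (5, a, b, i)
  | .add i => (6, i, 0, 0)
  | .acc => (7, 0, 0, 0)
  | .fin => (8, 0, 0, 0)

theorem State.code_injective : Function.Injective State.code := by
  rintro (_ | _) (_ | _) <;> simp [State.code]

/-- The states with parameters at most `B`. -/
def boundedStates (B : ℕ) : Set State := State.code ⁻¹' Set.Iic (8, B, B, B)

theorem finite_boundedStates (B : ℕ) : (boundedStates B).Finite :=
  (Set.finite_Iic _).preimage State.code_injective.injOn

/-- State parameters are remainders below `m`, coefficients, or numbers counting down from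
coefficients, so one bound confines them all. -/
theorem trans_mem_boundedStates {m B : ℕ} {tr : ℕ → Option (ℕ × ℕ)} (hmB : m ≤ B)
    (htr : ∀ r a b, tr r = some (a, b) → r < m ∧ a ≤ B ∧ b ≤ B) (q : State)
    (hq : q ∈ boundedStates B) (a : TapeSym (Fin 2)) (t : Bool) (q' : State) (i : CounterInstr)
    (d : Dir) (h : trans m tr q a t = some (q', i, d)) : q' ∈ boundedStates B := by
  simp only [boundedStates, Set.mem_preimage, Set.mem_Iic] at hq ⊢
  unfold trans at h
  split at h <;> (try split at h) <;> cases h <;>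
    simp only [State.code, Prod.mk_le_mk] at hq ⊢ <;> try omega
  have := htr _ _ _ ‹_›
  omega

/-- A one-counter machine with a bounded language and a store language that is not recursive. -/
theorem exists_counterMachine : ∃ (a q : ℕ) (M : CounterMachine (Fin a) (Fin q)),
    IsBounded M.language ∧ ¬ IsRecursive M.storeLanguage := by
  obtain ⟨m, tr, B, hm, hmB, htr, hund⟩ := exists_bounded_conwayHalts_undecidable
  obtain ⟨k, M, e, d, -, hacc, hstore⟩ := (machine m tr).exists_fin_machine
    (finite_boundedStates B) (by simp [machine, boundedStates, State.code])
    (trans_mem_boundedStates hmB htr)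
  refine ⟨2, k, M, isBounded_of_wellFormed ?_, not_isRecursive hund [Sum.inl (e .mark)]
    (Sum.inr ()) fun n => ?_⟩
  · rintro w ⟨c, n, h⟩
    exact wellFormed_of_isAccepting hm (hacc w c n h)
  · rw [← mark_mem_storeLanguage hm tr n, ← hstore _ (by simp [boundedStates, State.code])]
    simp

end Bounded

/-! ### Counting modulo `m` along a block of equal letters. -/

theorem succ_div_mod_of_lt {m y : ℕ} (h : y % m + 1 < m) :
    (y + 1) % m = y % m + 1 ∧ (y + 1) / m = y / m := by
  have h1 := Nat.div_add_mod y m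
  have := (Nat.div_mod_unique (a := y + 1) (b := m) (d := y / m) (c := y % m + 1) (by omega)).2
    ⟨by omega, h⟩
  exact ⟨this.2, this.1⟩

theorem succ_div_mod_of_le {m y : ℕ} (hm : 0 < m) (h : m ≤ y % m + 1) :
    (y + 1) % m = 0 ∧ (y + 1) / m = y / m + 1 := by
  have h1 := Nat.div_add_mod y m
  have h2 := Nat.mod_lt y hm
  have h3 : m * (y / m + 1) = m * (y / m) + m := by ring
  have := (Nat.div_mod_unique (a := y + 1) (b := m) (d := y / m + 1) (c := 0) hm).2
    ⟨by omega, hm⟩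
  exact ⟨this.2, this.1⟩

theorem tapeAt_letter_unique {A : Type} {v u : List A} {a b : A} {p : ℕ}
    (h : tapeAt (v ++ a :: u) p = some (.letter b)) (hp : p = v.length + 1) : b = a := by
  have := (tapeAt_eq_letter (w := v ++ a :: u)).2 ⟨v, u, rfl, hp⟩
  rw [h] at this
  simpa using this

section Block

variable {A : Type} {t : A} {v u : List A} {x y : ℕ} {s : A}

theorem tapeAt_block_lt (h : y < x) :
    tapeAt (v ++ List.replicate x t ++ s :: u) (v.length + y + 1) = some (.letter t) := by
  refine tapeAt_eq_letter.2 ⟨v ++ List.replicate y t, List.replicate (x - y - 1) t ++ s :: u, ?_,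
    by simp⟩
  rw [← List.cons_append, ← List.replicate_succ, List.append_assoc, List.append_assoc,
    ← List.append_assoc (List.replicate y t), ← List.replicate_add]
  congr 3
  omega

theorem tapeAt_block_end :
    tapeAt (v ++ List.replicate x t ++ s :: u) (v.length + x + 1) = some (.letter s) :=
  tapeAt_eq_letter.2 ⟨_, u, rfl, by simp⟩

/-- The symbol in a block of `t`s that is followed by the separator `s`. -/
theorem tapeAt_block {a : A} (hy : y ≤ x)
    (h : tapeAt (v ++ List.replicate x t ++ s :: u) (v.length + y + 1) = some (.letter a)) :
    y < x ∧ a = t ∨ y = x ∧ a = s := by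
  rcases hy.lt_or_eq with hy | rfl
  · rw [tapeAt_block_lt hy] at h
    exact .inl ⟨hy, by simpa using h.symm⟩
  · rw [tapeAt_block_end] at h
    exact .inr ⟨rfl, by simpa using h.symm⟩

end Block

/-! ### Finite crossing with one counter: checking a history on the input. -/

namespace CounterHistory

/-- The states of a machine that checks a history of a generalized Collatz map. -/
inductive State where
  | init
  | load
  | mark
  | unload
  | forward
  | read (r : ℕ)
  | cmp (a b j : ℕ)
  | tail (j : ℕ)
  | back
  | ret
  | acc
  | fin

/-- The input is a history `1^x₀ 0 1^x₁ 0 ⋯ 1^xₖ 0`. The machine counts to `x₀` and back; then, for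
each block but the last one, it divides its length by `m`, with the quotient in the counter, checks
that the next block has the length that the generalized Collatz map requires, and returns to the
beginning of that next block. -/
def trans (m : ℕ) (tr : ℕ → Option (ℕ × ℕ)) :
    State → TapeSym (Fin 2) → Bool → Option (State × CounterInstr × Dir)
  | .init, .leftEnd, _ => some (.load, .keep, .right)
  | .load, .letter a, _ =>
    if a = 0 then some (.mark, .keep, .stay) else some (.load, .inc, .right)
  -- The counter must be empty before the history is read. Walking back to the left end marker takes
  -- one decrement for each letter of the first block, so no zero test is needed.
  | .mark, .letter _, _ => some (.unload, .keep, .left)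
  | .unload, .leftEnd, _ => some (.forward, .keep, .stay)
  | .unload, .letter _, _ => some (.unload, .dec, .left)
  | .forward, .leftEnd, _ => some (.read 0, .keep, .right)
  | .forward, .letter _, _ => some (.read 0, .keep, .right)
  | .read r, .letter a, _ =>
    if a = 0 then
      match tr r with
      | none => some (.acc, .keep, .right)
      | some (a, b) => some (.cmp a b 0, .keep, .right)
    else if r + 1 < m then some (.read (r + 1), .keep, .right) else some (.read 0, .inc, .right)
  | .cmp a b (j + 1), .letter x, _ => if x = 0 then none else some (.cmp a b j, .keep, .right)
  | .cmp a b 0, _, true => some (.cmp a b a, .dec, .stay)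
  | .cmp _ b 0, _, false => some (.tail b, .keep, .stay)
  | .tail (j + 1), .letter x, _ => if x = 0 then none else some (.tail j, .keep, .right)
  | .tail 0, .letter x, _ => if x = 0 then some (.back, .keep, .stay) else none
  | .back, .letter _, _ => some (.ret, .keep, .left)
  | .ret, .letter a, _ =>
    if a = 0 then some (.forward, .keep, .stay) else some (.ret, .keep, .left)
  | .acc, .rightEnd, _ => some (.fin, .keep, .right)
  | _, _, _ => none

/-- The machine with transitions `trans m tr`. -/
def machine (m : ℕ) (tr : ℕ → Option (ℕ × ℕ)) : CounterMachine (Fin 2) State where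
  start := .init
  final := {.fin}
  trans := trans m tr

/-- The number of leading ones. -/
def lead (w : List (Fin 2)) : ℕ := (w.takeWhile (· = 1)).length

/-- An invariant of the computations on `w`. -/
def Inv (m : ℕ) (tr : ℕ → Option (ℕ × ℕ)) (w : List (Fin 2)) (c : Config State ℕ) : Prop :=
  let p := c.pos
  let z := c.store
  let H := ConwayHalts m tr
  match c.state with
  | .init => p = 0 ∧ z = 0
  | .load => p = z + 1 ∧ ∃ u, w = List.replicate z 1 ++ u
  | .mark => z = lead w ∧ p = z + 1 ∧ ∃ u, w = List.replicate (lead w) 1 ++ 0 :: u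
  | .unload => z = p ∧ ∃ u, w = List.replicate (lead w) 1 ++ 0 :: u
  | .forward => z = 0 ∧ ∃ x v u, w = v ++ List.replicate x 1 ++ 0 :: u ∧ p = v.length ∧
      (H x → H (lead w))
  | .read r => r < m ∧ ∃ x v u, w = v ++ List.replicate x 1 ++ 0 :: u ∧
      p = v.length + (m * z + r) + 1 ∧ m * z + r ≤ x ∧ (H x → H (lead w))
  | .cmp a b j => ∃ v y u, w = v ++ 0 :: List.replicate y 1 ++ u ∧ p = v.length + y + 2 ∧
      (H (y + j + a * z + b) → H (lead w))
  | .tail j => z = 0 ∧ ∃ v y u, w = v ++ 0 :: List.replicate y 1 ++ u ∧ p = v.length + y + 2 ∧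
      (H (y + j) → H (lead w))
  | .back => z = 0 ∧ ∃ v y u, w = v ++ 0 :: List.replicate y 1 ++ 0 :: u ∧ p = v.length + y + 2 ∧
      (H y → H (lead w))
  | .ret => z = 0 ∧ ∃ v y u k, w = v ++ 0 :: List.replicate y 1 ++ 0 :: u ∧ k ≤ y ∧
      p = v.length + k + 1 ∧ (H y → H (lead w))
  | .acc | .fin => H (lead w)

/-- Soundness. While a block is compared, its required length is the part `y` already read plus what
state and counter still demand: `y + j + a * z + b`, then `y + j`. When its separator is met with
nothing left to demand, the block has the required length `y` and takes over the role of `x`.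
Acceptance occurs only at a last block whose residue has no coefficients. -/
theorem inv_step {m : ℕ} (hm : 0 < m) {tr : ℕ → Option (ℕ × ℕ)} {w : List (Fin 2)}
    (c c' : Config State ℕ) (hI : Inv m tr w c) (h : (machine m tr).step w c = some c') :
    Inv m tr w c' := by
  obtain ⟨s, t, i, d, h1, h2, h3, h4, h5⟩ := Machine.step_eq_some.1 h
  obtain ⟨q, p, z⟩ := c
  obtain ⟨q', p', z'⟩ := c'
  simp only [machine, counter_read_eq] at h1 h2 h3 h4 h5
  cases q with
  | init =>
    cases s <;> simp only [trans, Option.some.injEq, Prod.mk.injEq, reduceCtorEq] at h3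
    obtain ⟨rfl, rfl, rfl⟩ := h3
    rw [move_right_eq] at h4
    rw [counter_keep_eq] at h5
    obtain ⟨hp, hz⟩ := hI
    simp only at hp hz
    subst hp hz h4 h5
    exact ⟨rfl, w, rfl⟩
  | load =>
    obtain ⟨hp, u, hw⟩ := hI
    simp only at hp hw
    cases s with
    | letter a =>
      obtain ⟨v, u', hw', hp'⟩ := tapeAt_eq_letter.1 h1
      obtain ⟨rfl, rfl⟩ : List.replicate z 1 = v ∧ u = a :: u' :=
        List.append_inj (hw.symm.trans hw') (by simp; omega)
      simp only [trans] at h3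
      split_ifs at h3 with ha <;> cases h3
      · rw [move_stay_eq] at h4
        rw [counter_keep_eq] at h5
        subst h4 h5 ha
        have hl : lead w = z' := by
          rw [hw, lead, takeWhile_replicate_append _ (by simp) (by simp)]
        exact ⟨hl.symm, by simp only; omega, u', by rw [hl]; exact hw⟩
      · rw [move_right_eq] at h4
        rw [counter_inc_eq] at h5
        obtain rfl : a = 1 := by omega
        subst h4 h5
        exact ⟨by simp only; omega, u', by rw [hw, List.replicate_succ']; simp⟩
    | _ => cases h3
  | mark =>
    obtain ⟨hz, hp, hw⟩ := hI
    simp only at hz hp hw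
    cases s with
    | letter a =>
      cases h3
      rw [move_left_eq] at h4
      rw [counter_keep_eq] at h5
      subst h4 h5
      exact ⟨by simp only; omega, hw⟩
    | _ => cases h3
  | unload =>
    obtain ⟨hz, u, hw⟩ := hI
    simp only at hz hw
    cases s with
    | leftEnd =>
      rw [tapeAt_eq_leftEnd] at h1
      cases h3
      rw [move_stay_eq] at h4
      rw [counter_keep_eq] at h5
      subst hz h1 h4 h5
      exact ⟨rfl, lead w, [], u, hw, rfl, id⟩
    | letter a =>
      cases h3
      rw [move_left_eq] at h4
      rw [counter_dec_eq] at h5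
      exact ⟨by simp only; omega, u, hw⟩
    | rightEnd => cases h3
  | forward =>
    obtain ⟨hz, x, v, u, hw, hp, hH⟩ := hI
    simp only at hz hp
    cases s with
    | rightEnd => cases h3
    | _ =>
      cases h3
      rw [move_right_eq] at h4
      rw [counter_keep_eq] at h5
      subst hz hp h4 h5
      exact ⟨hm, x, v, u, hw, rfl, Nat.zero_le _, hH⟩
  | read r =>
    obtain ⟨hr, x, v, u, hw, hp, hle, hH⟩ := hI
    simp only at hp hle
    cases s with
    | letter a =>
      rw [hw, hp] at h1
      rcases tapeAt_block hle h1 with ⟨hlt, rfl⟩ | ⟨rfl, rfl⟩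
      · simp only [trans, one_ne_zero, if_false] at h3
        split_ifs at h3 with hr' <;> cases h3 <;> rw [move_right_eq] at h4
        · rw [counter_keep_eq] at h5
          subst h4 h5
          exact ⟨hr', x, v, u, hw, by simp only; omega, by simp only; omega, hH⟩
        · rw [counter_inc_eq] at h5
          subst h4 h5
          obtain rfl : m = r + 1 := by omega
          have e : (r + 1) * (z + 1) = (r + 1) * z + r + 1 := by ring
          exact ⟨hm, x, v, u, hw, by simp only; omega, by simp only; omega, hH⟩
      · have hmod : (m * z + r) % m = r := by
          rw [Nat.mul_add_mod, Nat.mod_eq_of_lt hr]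
        have hdiv : (m * z + r) / m = z := by
          rw [Nat.mul_add_div hm, Nat.div_eq_of_lt hr, add_zero]
        simp only [trans, if_true] at h3
        split at h3 <;> rename_i htr <;> cases h3 <;> rw [counter_keep_eq] at h5 <;>
          rw [move_right_eq] at h4 <;> subst h4 h5
        · exact hH (conwayHalts_of_none (by rwa [hmod]))
        · refine ⟨v ++ List.replicate (m * z' + r) 1, 0, u, by simpa using hw,
            by simp only [List.length_append, List.length_replicate]; omega,
            fun h => hH (conwayHalts_of_some (by rwa [hmod]) ?_)⟩
          rw [hdiv]
          simpa using h
    | _ => cases h3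
  | cmp a b j =>
    obtain ⟨v, y, u, hw, hp, hH⟩ := hI
    simp only at hp hH
    cases j with
    | zero =>
      cases t with
      | true =>
        cases h3
        rw [counter_dec_eq] at h5
        rw [move_stay_eq] at h4
        subst h4 h5
        refine ⟨v, y, u, hw, hp, fun h => hH ?_⟩
        convert h using 1
        simp only
        ring
      | false =>
        cases h3
        rw [counter_keep_eq] at h5
        rw [move_stay_eq] at h4
        subst h4 h5
        obtain rfl : z' = 0 := by simpa using h2.symm
        exact ⟨rfl, v, y, u, hw, hp, by simpa using hH⟩
    | succ j =>
      cases s with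
      | letter x =>
        obtain ⟨v', u', hw', hp'⟩ := tapeAt_eq_letter.1 h1
        obtain ⟨rfl, rfl⟩ : _ = v' ∧ u = x :: u' :=
          List.append_inj (hw.symm.trans hw') (by simp; omega)
        simp only [trans] at h3
        split_ifs at h3 with hx
        cases h3
        rw [counter_keep_eq] at h5
        rw [move_right_eq] at h4
        obtain rfl : x = 1 := by omega
        subst h4 h5
        refine ⟨v, y + 1, u', by rw [hw, List.replicate_succ']; simp, by simp only; omega,
          fun h => hH ?_⟩
        convert h using 1
        simp only
        ring
      | _ => cases h3
  | tail j =>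
    obtain ⟨hz, v, y, u, hw, hp, hH⟩ := hI
    simp only at hz hp hH
    cases s with
    | letter x =>
      obtain ⟨v', u', hw', hp'⟩ := tapeAt_eq_letter.1 h1
      obtain ⟨rfl, rfl⟩ : _ = v' ∧ u = x :: u' :=
        List.append_inj (hw.symm.trans hw') (by simp; omega)
      cases j with
      | zero =>
        simp only [trans] at h3
        split_ifs at h3 with hx
        cases h3
        rw [counter_keep_eq] at h5
        rw [move_stay_eq] at h4
        subst hz h4 h5 hx
        exact ⟨rfl, v, y, u', hw, hp, hH⟩
      | succ j =>
        simp only [trans] at h3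
        split_ifs at h3 with hx
        cases h3
        rw [counter_keep_eq] at h5
        rw [move_right_eq] at h4
        obtain rfl : x = 1 := by omega
        subst hz h4 h5
        refine ⟨rfl, v, y + 1, u', by rw [hw, List.replicate_succ']; simp, by simp only; omega,
          fun h => hH ?_⟩
        convert h using 1
        ring
    | _ => cases j <;> cases h3
  | back =>
    obtain ⟨hz, v, y, u, hw, hp, hH⟩ := hI
    simp only at hz hp
    cases s with
    | letter x =>
      cases h3
      rw [counter_keep_eq] at h5
      rw [move_left_eq] at h4
      subst hz h5
      exact ⟨rfl, v, y, u, y, hw, le_rfl, by simp only; omega, hH⟩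
    | _ => cases h3
  | ret =>
    obtain ⟨hz, v, y, u, k, hw, hk, hp, hH⟩ := hI
    simp only at hz hp
    cases s with
    | letter x =>
      cases k with
      | zero =>
        obtain rfl : x = 0 := by
          rw [hw, List.append_assoc, List.cons_append] at h1
          exact tapeAt_letter_unique h1 hp
        cases h3
        rw [counter_keep_eq] at h5
        rw [move_stay_eq] at h4
        subst hz h4 h5
        exact ⟨rfl, y, v ++ [0], u, by rw [hw]; simp, by simp [hp], hH⟩
      | succ k =>
        obtain rfl : x = 1 := by
          have e : v.length + (k + 1) + 1 = (v ++ [0]).length + k + 1 := by simp; omega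
          rw [hw, List.append_cons v, hp, e] at h1
          have := tapeAt_block (by omega) h1
          omega
        cases h3
        rw [counter_keep_eq] at h5
        rw [move_left_eq] at h4
        subst hz h5
        exact ⟨rfl, v, y, u, k, hw, by omega, by simp only; omega, hH⟩
    | _ => cases h3
  | acc =>
    cases s <;> cases h3
    exact hI
  | fin => cases s <;> cases h3

section Accepts

variable {m : ℕ} {tr : ℕ → Option (ℕ × ℕ)} {w v u : List (Fin 2)} {x : ℕ}

theorem step_intro {q q' : State} {p p' z z' : ℕ} {a : TapeSym (Fin 2)} {i : CounterInstr}
    {d : Dir} (h1 : tapeAt w p = some a) (h2 : trans m tr q a (decide (z ≠ 0)) = some (q', i, d))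
    (h3 : d.move p = some p') (h4 : counterStore.apply i z = some z') :
    (machine m tr).step w ⟨q, p, z⟩ = some ⟨q', p', z'⟩ :=
  Machine.step_eq_some.2 ⟨a, _, i, d, h1, rfl, h2, h3, h4⟩

theorem acceptsFrom_read (hm : 0 < m) (hw : w = v ++ List.replicate x 1 ++ 0 :: u)
    (h : (machine m tr).AcceptsFrom w ⟨.read (x % m), v.length + x + 1, x / m⟩) :
    (machine m tr).AcceptsFrom w ⟨.read 0, v.length + 1, 0⟩ := by
  have := Nat.decreasingInduction' (P := fun y => (machine m tr).AcceptsFrom w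
    ⟨.read (y % m), v.length + y + 1, y / m⟩) (fun y hy _ ih => ?_) (Nat.zero_le x) h
  · simpa using this
  · have hs := tapeAt_block_lt (t := (1 : Fin 2)) (v := v) (s := 0) (u := u) hy
    rw [← hw] at hs
    by_cases hr : y % m + 1 < m
    · rw [(succ_div_mod_of_lt hr).1, (succ_div_mod_of_lt hr).2] at ih
      exact ih.head (step_intro (i := .keep) (d := .right) hs (by simp [trans, hr]) rfl rfl)
    · rw [(succ_div_mod_of_le hm (by omega)).1, (succ_div_mod_of_le hm (by omega)).2] at ih
      exact ih.head (step_intro (i := .inc) (d := .right) hs (by simp [trans, hr]) rfl rfl)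

theorem acceptsFrom_tail {y j : ℕ} (hw : w = v ++ List.replicate x 1 ++ 0 :: u) (hx : y + j = x)
    (h : (machine m tr).AcceptsFrom w ⟨.back, v.length + x + 1, 0⟩) :
    (machine m tr).AcceptsFrom w ⟨.tail j, v.length + y + 1, 0⟩ := by
  induction j generalizing y with
  | zero =>
    have hs := tapeAt_block_end (t := (1 : Fin 2)) (v := v) (s := 0) (u := u) (x := x)
    rw [← hw] at hs
    obtain rfl : y = x := hx
    exact h.head (step_intro hs rfl rfl rfl)
  | succ j ih =>
    have hs := tapeAt_block_lt (t := (1 : Fin 2)) (v := v) (s := 0) (u := u) (x := x) (y := y)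
      (by omega)
    rw [← hw] at hs
    exact (ih (y := y + 1) (by omega)).head (step_intro hs rfl rfl rfl)

/-- The outer induction is on the quotient left in the counter, each unit of which demands `a`
letters; the inner one is on the letters still due for the current unit. -/
theorem acceptsFrom_cmp {a b j y z : ℕ} (hw : w = v ++ List.replicate x 1 ++ 0 :: u)
    (hx : y + j + a * z ≤ x)
    (h : (machine m tr).AcceptsFrom w ⟨.tail b, v.length + (y + j + a * z) + 1, 0⟩) :
    (machine m tr).AcceptsFrom w ⟨.cmp a b j, v.length + y + 1, z⟩ := by
  induction z generalizing y j with
  | zero =>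
    induction j generalizing y with
    | zero =>
      obtain ⟨s, hs⟩ := exists_tapeAt (w := w) (p := v.length + y + 1) (by rw [hw]; simp; omega)
      refine Machine.AcceptsFrom.head ?_ (step_intro hs rfl rfl rfl)
      simpa using h
    | succ j ih =>
      have hs := tapeAt_block_lt (t := (1 : Fin 2)) (v := v) (s := 0) (u := u) (x := x) (y := y)
        (by omega)
      rw [← hw] at hs
      refine (ih (y := y + 1) (by omega) ?_).head (step_intro hs rfl rfl rfl)
      convert h using 2
      omega
  | succ z ihz =>
    have e : a * (z + 1) = a * z + a := by ring
    induction j generalizing y with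
    | zero =>
      obtain ⟨s, hs⟩ := exists_tapeAt (w := w) (p := v.length + y + 1) (by rw [hw]; simp; omega)
      refine (ihz (y := y) (j := a) (by omega) ?_).head
        (step_intro (i := .dec) (d := .stay) hs (by simp [trans]) rfl rfl)
      convert h using 2
      omega
    | succ j ih =>
      have hs := tapeAt_block_lt (t := (1 : Fin 2)) (v := v) (s := 0) (u := u) (x := x) (y := y)
        (by omega)
      rw [← hw] at hs
      refine (ih (y := y + 1) (by omega) ?_).head (step_intro hs rfl rfl rfl)
      convert h using 2
      omega

theorem acceptsFrom_ret {k : ℕ} (hw : w = v ++ 0 :: List.replicate x 1 ++ 0 :: u) (hk : k ≤ x)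
    (h : (machine m tr).AcceptsFrom w ⟨.forward, v.length + 1, 0⟩) :
    (machine m tr).AcceptsFrom w ⟨.ret, v.length + 1 + k, 0⟩ := by
  induction k with
  | zero =>
    refine h.head (step_intro (i := .keep) (d := .stay) (a := .letter 0)
      (tapeAt_eq_letter.2 ⟨v, List.replicate x 1 ++ 0 :: u, ?_, rfl⟩)
      rfl rfl rfl)
    rw [hw]
    simp
  | succ k ih =>
    have hs := tapeAt_block_lt (t := (1 : Fin 2)) (v := v ++ [0]) (s := 0) (u := u) (x := x)
      (y := k) (by omega)
    rw [← List.append_cons, ← hw, List.length_append, List.length_singleton] at hs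
    exact (ih (by omega)).head (step_intro hs rfl rfl rfl)

/-- The remaining history `u` depends on `x` alone and works after every prefix `v`, so the
induction on the number of steps can put a block in front. The head starts on the cell just before
the block. -/
theorem exists_acceptsFrom_of_haltsIn (hm : 0 < m) {k : ℕ} (h : HaltsIn (conwayStep m tr) k x) :
    ∃ u, ∀ v w : List (Fin 2), w = v ++ List.replicate x 1 ++ 0 :: u →
      (machine m tr).AcceptsFrom w ⟨.forward, v.length, 0⟩ := by
  have start : ∀ {w v u : List (Fin 2)} {x}, w = v ++ List.replicate x 1 ++ 0 :: u →
      (machine m tr).AcceptsFrom w ⟨.read (x % m), v.length + x + 1, x / m⟩ →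
      (machine m tr).AcceptsFrom w ⟨.forward, v.length, 0⟩ := by
    intro w v u x hw h
    obtain ⟨s, hs⟩ := exists_tapeAt (w := w) (p := v.length) (by rw [hw]; simp; omega)
    cases s with
    | rightEnd =>
      rw [tapeAt_eq_rightEnd, hw] at hs
      simp at hs
      omega
    | _ => exact (acceptsFrom_read hm hw h).head (step_intro hs rfl rfl rfl)
  induction k generalizing x with
  | zero =>
    refine ⟨[], fun v w hw => start hw ?_⟩
    have htr : tr (x % m) = none := by simpa [HaltsIn, conwayStep] using h
    have hs := tapeAt_block_end (t := (1 : Fin 2)) (v := v) (s := 0) (u := []) (x := x)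
    rw [← hw] at hs
    have hacc : (machine m tr).AcceptsFrom w ⟨.acc, v.length + x + 2, x / m⟩ :=
      ⟨⟨.fin, w.length + 2, x / m⟩, .single (step_intro (tapeAt_eq_rightEnd.2 (by simp [hw]; omega))
        rfl (by simp [hw, Dir.move]; omega) rfl), rfl, rfl⟩
    exact hacc.head (step_intro (i := .keep) (d := .right) hs (by simp [trans, htr]) rfl rfl)
  | succ k ih =>
    obtain ⟨y, hy, h⟩ := h
    obtain ⟨u, hu⟩ := ih h
    refine ⟨List.replicate y 1 ++ 0 :: u, fun v w hw => start hw ?_⟩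
    obtain ⟨⟨a, b⟩, htr, rfl⟩ : ∃ ab, tr (x % m) = some ab ∧ ab.1 * (x / m) + ab.2 = y := by
      simpa [conwayStep] using hy
    have hs := tapeAt_block_end (t := (1 : Fin 2)) (v := v) (s := 0) (x := x)
      (u := List.replicate (a * (x / m) + b) 1 ++ 0 :: u)
    rw [← hw] at hs
    set v' := v ++ List.replicate x 1 with hv'
    have hl : v'.length = v.length + x := by simp [hv']
    have hw' : w = (v' ++ [0]) ++ List.replicate (a * (x / m) + b) 1 ++ 0 :: u := by
      rw [hw]; simp
    have hw'' : w = v' ++ 0 :: List.replicate (a * (x / m) + b) 1 ++ 0 :: u := by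
      rw [hw]; simp
    have hl' : (v' ++ [0]).length = v'.length + 1 := by simp
    have hs' := tapeAt_block_end (t := (1 : Fin 2)) (v := v' ++ [0]) (s := 0)
      (x := a * (x / m) + b) (u := u)
    rw [← hw'] at hs'
    have next := hu _ w hw'
    rw [hl'] at next
    have hret := (acceptsFrom_ret hw'' le_rfl next).head
      (step_intro (q := .back) (z := 0) (p := (v' ++ [0]).length + (a * (x / m) + b) + 1) hs' rfl
        (by rw [hl']; rfl) rfl)
    have hcmp := acceptsFrom_cmp (a := a) (b := b) (j := 0) (y := 0) (z := x / m) hw' (by omega)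
      (acceptsFrom_tail hw' (by omega) hret)
    refine hcmp.head (step_intro (i := .keep) (d := .right) hs (by simp [trans, htr]) ?_ rfl)
    rw [hl', hl]
    rfl

theorem reaches_mark {n : ℕ} (hw : w = List.replicate n 1 ++ 0 :: u) :
    (machine m tr).Reaches w (machine m tr).initConfig ⟨.mark, n + 1, n⟩ := by
  have load : ∀ k ≤ n, (machine m tr).Reaches w (machine m tr).initConfig ⟨.load, k + 1, k⟩ := by
    intro k
    induction k with
    | zero => exact fun _ => .single (step_intro (tapeAt_eq_leftEnd.2 rfl) rfl rfl rfl)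
    | succ k ih =>
      intro hk
      have hs := tapeAt_block_lt (t := (1 : Fin 2)) (v := []) (s := 0) (u := u) (x := n) (y := k) hk
      rw [List.nil_append, ← hw, List.length_nil, zero_add] at hs
      exact (ih (by omega)).tail (step_intro hs rfl rfl rfl)
  exact (load n le_rfl).tail (step_intro (tapeAt_eq_letter.2 ⟨_, _, hw, by simp⟩) rfl rfl rfl)

theorem acceptsFrom_mark {n : ℕ} (hw : w = List.replicate n 1 ++ 0 :: u)
    (h : (machine m tr).AcceptsFrom w ⟨.forward, 0, 0⟩) :
    (machine m tr).AcceptsFrom w ⟨.mark, n + 1, n⟩ := by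
  have unload : ∀ k ≤ n, (machine m tr).AcceptsFrom w ⟨.unload, k, k⟩ := by
    intro k
    induction k with
    | zero => exact fun _ => h.head (step_intro (tapeAt_eq_leftEnd.2 rfl) rfl rfl rfl)
    | succ k ih =>
      intro hk
      have hs := tapeAt_block_lt (t := (1 : Fin 2)) (v := []) (s := 0) (u := u) (x := n) (y := k) hk
      rw [List.nil_append, ← hw, List.length_nil, zero_add] at hs
      exact (ih (by omega)).head (step_intro hs rfl rfl rfl)
  exact (unload n le_rfl).head
    (step_intro (tapeAt_eq_letter.2 ⟨_, _, hw, by simp⟩) rfl rfl rfl)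

end Accepts

/-- The machine is in `mark` with the length of the first block as its counter. Acceptance certifies
the whole history, and a terminating iteration supplies one. -/
theorem mark_mem_storeLanguage {m : ℕ} (hm : 0 < m) (tr : ℕ → Option (ℕ × ℕ)) (n : ℕ) :
    Sum.inl State.mark :: (List.replicate n ()).map Sum.inr ∈ (machine m tr).storeLanguage ↔
      ConwayHalts m tr n := by
  constructor
  · rintro ⟨w, c, N, h, j, hj, hu⟩
    have inv := h.1.invariant (Inv m tr w) ⟨rfl, rfl⟩ (inv_step hm)
    simp only [List.cons.injEq, Sum.inl.injEq, List.map_inj_right fun _ _ => Sum.inr.inj] at hu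
    have hz : n = (c j).store := by simpa [counterStore] using congrArg List.length hu.2
    have hmark := inv j hj
    simp only [Inv, ← hu.1] at hmark
    have hfin := inv N le_rfl
    have hstate : (c N).state = .fin := h.2.1
    simp only [Inv, hstate] at hfin
    rw [hz, hmark.1]
    exact hfin
  · rintro ⟨k, hk⟩
    obtain ⟨u, hu⟩ := exists_acceptsFrom_of_haltsIn hm hk
    obtain ⟨c, N, h, j, hj, hc⟩ := Machine.exists_isAccepting (reaches_mark (u := u) rfl)
      (acceptsFrom_mark (n := n) (u := u) rfl (hu [] _ rfl))
    exact ⟨_, c, N, h, j, hj, by rw [hc]; rfl⟩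

/-- The kinds of phases in which the head moves in one direction only. -/
def State.kind : State → Fin 8
  | .init => 0
  | .load => 1
  | .mark | .unload => 2
  | .cmp .. | .tail _ | .acc | .fin => 3
  | .back => 4
  | .ret => 5
  | .forward => 6
  | .read _ => 7

/-- The number of a phase, in terms of the number of separators to the left of the head. -/
def phase (w : List (Fin 2)) (k : Fin 8) (p : ℕ) : ℕ :=
  -- `x` omits the scanned cell and `y` includes it. States that run back to, or start from, the
  -- separator before a block need `y`, so that standing on that separator already counts as the
  -- round of the block.
  let x := (w.take (p - 1)).count 0
  let y := (w.take p).count 0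
  -- The three initial kinds occur once; the other five recur for each block. Their offsets are
  -- distinct modulo `5` and exceed the initial values, so the number determines the kind.
  ![0, 1, 2, 5 * x + 10, 5 * x + 11, 5 * y + 12, 5 * y + 13, 5 * x + 14] k

theorem count_take_of_tapeAt {w : List (Fin 2)} {p : ℕ} {a : Fin 2}
    (h : tapeAt w p = some (.letter a)) :
    (w.take p).count 0 = (w.take (p - 1)).count 0 + if a = 0 then 1 else 0 := by
  obtain ⟨v, u, rfl, rfl⟩ := tapeAt_eq_letter.1 h
  simp only [Nat.add_sub_cancel, List.take_left']
  rw [List.append_cons, List.take_left' (by simp), List.count_append, List.count_singleton]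
  simp

theorem count_take_le (w : List (Fin 2)) (p : ℕ) :
    (w.take (p - 1)).count 0 ≤ (w.take p).count 0 :=
  (List.take_sublist_take_left (Nat.sub_le p 1)).count_le 0

/-- Every block is passed by the comparison from its predecessor, by the return, and by the reading
of its own length. Phase numbers are nondecreasing, so each of the eight kinds crosses a given
boundary at most once; the kinds `2`, `4` and `5` are those moving left. -/
theorem crossings_machine_le {m : ℕ} {tr : ℕ → Option (ℕ × ℕ)} {w : List (Fin 2)}
    {c : ℕ → Config State ℕ} {n : ℕ} (h : (machine m tr).IsComputation w c n) (r : ℕ) :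
    Machine.crossings c n r ≤ 8 := by
  refine Machine.crossings_le h.2 State.kind (phase w) (fun k => k ∉ ({2, 4, 5} : Finset (Fin 8)))
    (fun k k' p p' => ?_) (fun c c' h => ?_) r
  · fin_cases k <;> fin_cases k' <;> simp [phase] <;> omega
  · obtain ⟨s, t, i, d, h1, -, h3, h4, -⟩ := Machine.step_eq_some.1 h
    obtain ⟨q, p, z⟩ := c
    obtain ⟨q', p', z'⟩ := c'
    simp only [machine] at h1 h3 h4
    have hle := count_take_le w p
    unfold trans at h3
    split at h3 <;> (try split at h3) <;> (try split at h3) <;> cases h3 <;>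
      (try have hc := count_take_of_tapeAt h1) <;>
      first
        | rw [move_right_eq] at h4
        | rw [move_stay_eq] at h4
        | rw [move_left_eq] at h4
    all_goals
      subst h4
      simp_all [State.kind, phase]
    all_goals omega

/-- The tag and the parameters of a state. -/
def State.code : State → ℕ × ℕ × ℕ × ℕ
  | .init => (0, 0, 0, 0)
  | .load => (1, 0, 0, 0)
  | .mark => (2, 0, 0, 0)
  | .unload => (3, 0, 0, 0)
  | .forward => (4, 0, 0, 0)
  | .read r => (5, r, 0, 0)
  | .cmp a b j => (6, a, b, j)
  | .tail j => (7, j, 0, 0)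
  | .back => (8, 0, 0, 0)
  | .ret => (9, 0, 0, 0)
  | .acc => (10, 0, 0, 0)
  | .fin => (11, 0, 0, 0)

theorem State.code_injective : Function.Injective State.code := by
  rintro (_ | _) (_ | _) <;> simp [State.code]

/-- The states with parameters at most `B`. -/
def boundedStates (B : ℕ) : Set State := State.code ⁻¹' Set.Iic (11, B, B, B)

theorem finite_boundedStates (B : ℕ) : (boundedStates B).Finite :=
  (Set.finite_Iic _).preimage State.code_injective.injOn

theorem trans_mem_boundedStates {m B : ℕ} {tr : ℕ → Option (ℕ × ℕ)} (hmB : m ≤ B)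
    (htr : ∀ r a b, tr r = some (a, b) → r < m ∧ a ≤ B ∧ b ≤ B) (q : State)
    (hq : q ∈ boundedStates B) (a : TapeSym (Fin 2)) (t : Bool) (q' : State) (i : CounterInstr)
    (d : Dir) (h : trans m tr q a t = some (q', i, d)) : q' ∈ boundedStates B := by
  simp only [boundedStates, Set.mem_preimage, Set.mem_Iic] at hq ⊢
  unfold trans at h
  split at h <;> (try split at h) <;> (try split at h) <;> cases h <;>
    simp only [State.code, Prod.mk_le_mk] at hq ⊢ <;> try omega
  have := htr _ _ _ ‹_›
  omega

/-- A finite-crossing one-counter machine with a store language that is not recursive. -/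
theorem exists_counterMachine : ∃ (a q : ℕ) (M : CounterMachine (Fin a) (Fin q)),
    M.FiniteCrossing ∧ ¬ IsRecursive M.storeLanguage := by
  obtain ⟨m, tr, B, hm, hmB, htr, hund⟩ := exists_bounded_conwayHalts_undecidable
  obtain ⟨k, M, e, d, hcomp, -, hstore⟩ := (machine m tr).exists_fin_machine
    (finite_boundedStates B) (by simp [machine, boundedStates, State.code])
    (trans_mem_boundedStates hmB htr)
  refine ⟨2, k, M, ⟨8, fun w c n h r => crossings_machine_le (hcomp w c n h.1) r⟩,
    not_isRecursive hund [Sum.inl (e .mark)] (Sum.inr ()) fun n => ?_⟩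
  rw [← mark_mem_storeLanguage hm tr n, ← hstore _ (by simp [boundedStates, State.code])]
  simp

end CounterHistory

/-! ### The instructions of a pushdown. -/

section Pushdown

variable {Γ : Type} {Z₀ a : Γ} {s s' : List Γ}

theorem pushdown_keep_eq : (pushdownStore Z₀).apply .keep s = some s' ↔ s' = s := by
  simp [pushdownStore, eq_comm]

theorem pushdown_push_eq : (pushdownStore Z₀).apply (.push a) s = some s' ↔ s' = a :: s := by
  simp [pushdownStore, eq_comm]

theorem pushdown_pop_eq : (pushdownStore Z₀).apply .pop s = some s' ↔ ∃ b, s = b :: s' := by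
  cases s <;> simp [pushdownStore]

theorem pushdown_read_eq : (pushdownStore Z₀).read s = some a ↔ s.head? = some a := Iff.rfl

end Pushdown

/-! ### Finite crossing with a one-turn pushdown: checking a history backwards. -/

namespace PushdownHistory

/-- The states of a pushdown automaton that checks a history of a generalized Collatz map. -/
inductive State where
  | init
  | load
  | mark
  | rest
  | turn
  | top
  | verify (r a b j : ℕ)
  | popA (r a b i : ℕ)
  | popB (i : ℕ)
  | sep
  | acc
  | fin

/-- The input is a history `1^x₀ r₀ 1^x₁ r₁ ⋯ 1^xₖ rₖ`, with the letter `m` for `1` and the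
remainder `rᵢ < m` of `xᵢ` as a separator. The machine pushes the history, with `2` for all
separators. Then it reads the history from right to left; while it reads block `i`, it pops block
`i + 1` and checks that its length is the one that the generalized Collatz map requires. -/
def trans (m : ℕ) (tr : ℕ → Option (ℕ × ℕ)) :
    State → TapeSym (Fin (m + 1)) → Fin 3 → Option (State × PushdownInstr (Fin 3) × Dir)
  | .init, .leftEnd, _ => some (.load, .keep, .right)
  | .load, .letter a, _ =>
    if a = Fin.last m then some (.load, .push 1, .right) else some (.mark, .keep, .stay)
  | .mark, .letter _, _ => some (.rest, .push 2, .right)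
  | .rest, .letter a, _ =>
    if a = Fin.last m then some (.rest, .push 1, .right) else some (.rest, .push 2, .right)
  | .rest, .rightEnd, _ => some (.turn, .keep, .stay)
  | .turn, .rightEnd, _ => some (.top, .keep, .left)
  -- No block lies above the last one, so its coefficients are set to `0`: nothing but its separator
  -- is popped while it is read.
  | .top, .letter a, _ =>
    if a = Fin.last m then none
    else if tr a = none then some (.verify a 0 0 0, .keep, .left) else none
  -- Reading backwards meets the claimed remainder `r` before the block itself. The coefficients are
  -- thus known in time, and the count `j` modulo `m` confirms the claim at the other end of the
  -- block.
  | .verify r a b j, .letter x, _ =>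
    if x = Fin.last m then
      if j + 1 < m then some (.verify r a b (j + 1), .keep, .left)
      else some (.popA r a b a, .keep, .left)
    else if j = r then some (.popB b, .keep, .stay) else none
  | .verify r _ b j, .leftEnd, _ => if j = r then some (.popB b, .keep, .stay) else none
  | .popA r a b (i + 1), _, t => if t = 1 then some (.popA r a b i, .pop, .stay) else none
  | .popA r a b 0, _, _ => some (.verify r a b 0, .keep, .stay)
  | .popB (i + 1), _, t => if t = 1 then some (.popB i, .pop, .stay) else none
  | .popB 0, _, t => if t = 2 then some (.sep, .pop, .stay) else none
  | .sep, .letter x, _ =>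
    match tr x with
    | none => none
    | some (a, b) => some (.verify x a b 0, .keep, .left)
  | .sep, .leftEnd, _ => some (.acc, .keep, .stay)
  | .acc, .leftEnd, _ => some (.acc, .keep, .right)
  | .acc, .letter _, _ => some (.acc, .keep, .right)
  | .acc, .rightEnd, _ => some (.fin, .keep, .right)
  | _, _, _ => none

/-- The machine with transitions `trans m tr`. -/
def machine (m : ℕ) (tr : ℕ → Option (ℕ × ℕ)) :
    PushdownMachine (Fin (m + 1)) State (0 : Fin 3) where
  start := .init
  final := {.fin}
  trans := trans m tr

/-- The number of leading letters `m`. -/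
def lead {m : ℕ} (w : List (Fin (m + 1))) : ℕ := (w.takeWhile (· = Fin.last m)).length

/-- The pushdown after `v` has been pushed. -/
def stack {m : ℕ} (v : List (Fin (m + 1))) : List (Fin 3) :=
  (v.map fun a => if a = Fin.last m then 1 else 2).reverse ++ [0]

/-- A block of letters `m`. -/
abbrev block (m n : ℕ) : List (Fin (m + 1)) := List.replicate n (Fin.last m)

variable {m : ℕ}

theorem stack_append_singleton (v : List (Fin (m + 1))) (a : Fin (m + 1)) :
    stack (v ++ [a]) = (if a = Fin.last m then 1 else 2) :: stack v := by
  simp [stack]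

theorem stack_append_block (v : List (Fin (m + 1))) (n : ℕ) :
    stack (v ++ block m n) = List.replicate n 1 ++ stack v := by
  simp [stack]

theorem lead_eq {n : ℕ} {a : Fin (m + 1)} {u : List (Fin (m + 1))} (ha : a ≠ Fin.last m) :
    lead (block m n ++ a :: u) = n :=
  takeWhile_replicate_append n (by simp) (by simpa using ha)

theorem eq_append_of_tapeAt {A : Type} {v u : List A} {a : A}
    (h : tapeAt (v ++ u) v.length = some (.letter a)) : ∃ v', v = v' ++ [a] := by
  obtain ⟨v', u', h1, h2⟩ := tapeAt_eq_letter.1 h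
  rw [List.append_cons] at h1
  exact ⟨v', (List.append_inj h1 (by simp [h2])).1⟩

theorem val_lt_of_ne_last {a : Fin (m + 1)} (h : a ≠ Fin.last m) : (a : ℕ) < m :=
  Fin.lt_last_iff_ne_last.2 h

/-- What is known when the block of separator `r` has been read up to `y` letters, and of the
block above it `s` letters are left, `i` of which are due. -/
def Due (m : ℕ) (tr : ℕ → Option (ℕ × ℕ)) (r a b y s i : ℕ) : Prop :=
  -- `X` is the full length of the block above. The first alternative is the case of the last block,
  -- which has none above it.
  tr r = none ∨ tr r = some (a, b) ∧ ∃ X, s + a * (y / m) = X + i ∧ ConwayHalts m tr X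

/-- An invariant of the computations on `w`. -/
def Inv (m : ℕ) (tr : ℕ → Option (ℕ × ℕ)) (w : List (Fin (m + 1)))
    (c : Config State (List (Fin 3))) : Prop :=
  let p := c.pos
  let z := c.store
  let H := ConwayHalts m tr
  match c.state with
  | .init => p = 0 ∧ z = [0]
  | .load => ∃ y u, w = block m y ++ u ∧ p = y + 1 ∧ z = stack (block m y)
  | .mark => z = stack (block m (lead w)) ∧ p = lead w + 1 ∧
      ∃ a u, w = block m (lead w) ++ a :: u ∧ a ≠ Fin.last m
  | .rest => ∃ v u, w = v ++ u ∧ p = v.length + 1 ∧ z = stack v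
  | .turn => p = w.length + 1 ∧ z = stack w
  | .top => p = w.length ∧ z = stack w
  | .verify r a b j => ∃ v y, ∃ c : Fin (m + 1), ∃ u s,
      w = v ++ block m y ++ c :: u ∧ p = v.length ∧ (c : ℕ) = r ∧
      r < m ∧ j = y % m ∧ z = List.replicate s 1 ++ 2 :: stack (v ++ block m y) ∧
      Due m tr r a b y s 0
  | .popA r a b i => ∃ v y, ∃ c : Fin (m + 1), ∃ u s,
      w = v ++ block m y ++ c :: u ∧ p = v.length ∧ (c : ℕ) = r ∧
      r < m ∧ y % m = 0 ∧ z = List.replicate s 1 ++ 2 :: stack (v ++ block m y) ∧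
      Due m tr r a b y s i
  | .popB i => ∃ v y, ∃ c : Fin (m + 1), ∃ u s,
      w = v ++ block m y ++ c :: u ∧ p = v.length ∧ c ≠ Fin.last m ∧
      z = List.replicate s 1 ++ 2 :: stack (v ++ block m y) ∧ (s = i → H y)
  | .sep => ∃ v y, ∃ c : Fin (m + 1), ∃ u,
      w = v ++ block m y ++ c :: u ∧ p = v.length ∧ c ≠ Fin.last m ∧
      z = stack (v ++ block m y) ∧ H y
  | .acc | .fin => H (lead w)

/-- Soundness. The pushdown holds the `s` letters left of the block above, then the separator of the
current block, then everything below. Reading a letter of the block shortens `v` and lengthens `y`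
but leaves `v ++ block m y` unchanged. Halting is carried from the right end of the history to its
first block. -/
theorem inv_step (hm : 0 < m) {tr : ℕ → Option (ℕ × ℕ)}
    (htr : ∀ r a b, tr r = some (a, b) → r < m) {w : List (Fin (m + 1))}
    (c c' : Config State (List (Fin 3))) (hI : Inv m tr w c)
    (h : (machine m tr).step w c = some c') : Inv m tr w c' := by
  obtain ⟨s, t, i, d, h1, h2, h3, h4, h5⟩ := Machine.step_eq_some.1 h
  obtain ⟨q, p, z⟩ := c
  obtain ⟨q', p', z'⟩ := c'
  simp only [machine, pushdown_read_eq] at h1 h2 h3 h4 h5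
  cases q with
  | init =>
    cases s <;> simp only [trans, Option.some.injEq, Prod.mk.injEq, reduceCtorEq] at h3
    obtain ⟨rfl, rfl, rfl⟩ := h3
    rw [move_right_eq] at h4
    rw [pushdown_keep_eq] at h5
    obtain ⟨hp, hz⟩ := hI
    simp only at hp hz
    subst hp hz h4 h5
    exact ⟨0, w, rfl, rfl, rfl⟩
  | load =>
    obtain ⟨y, u, hw, hp, hz⟩ := hI
    simp only at hp hz
    cases s with
    | letter a =>
      obtain ⟨v, u', hw', hp'⟩ := tapeAt_eq_letter.1 h1
      obtain ⟨rfl, rfl⟩ : block m y = v ∧ u = a :: u' :=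
        List.append_inj (hw.symm.trans hw') (by simp; omega)
      simp only [trans] at h3
      split_ifs at h3 with ha <;> cases h3
      · rw [move_right_eq] at h4
        rw [pushdown_push_eq] at h5
        subst h4 h5 ha hz
        exact ⟨y + 1, u', by rw [hw, block, block, List.replicate_succ']; simp,
          by simp only; omega, by simp [block, List.replicate_succ', stack_append_singleton]⟩
      · rw [move_stay_eq] at h4
        rw [pushdown_keep_eq] at h5
        subst h4 h5 hz
        have hl : lead w = y := by rw [hw, lead_eq ha]
        exact ⟨by rw [hl], by simp only; omega, a, u', by rw [hl]; exact hw, ha⟩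
    | _ => cases h3
  | mark =>
    obtain ⟨hz, hp, a, u, hw, ha⟩ := hI
    simp only at hz hp
    cases s with
    | letter x =>
      obtain rfl : x = a := by
        rw [hw] at h1
        exact tapeAt_letter_unique h1 (by simp [hp])
      cases h3
      rw [move_right_eq] at h4
      rw [pushdown_push_eq] at h5
      subst h4 h5
      refine ⟨block m (lead w) ++ [x], u,
        by conv_lhs => rw [hw, List.append_cons], by simp [hp], ?_⟩
      rw [stack_append_singleton, if_neg ha, ← hz]
    | _ => cases h3
  | rest =>
    obtain ⟨v, u, hw, hp, hz⟩ := hI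
    simp only at hp hz
    cases s with
    | leftEnd => cases h3
    | letter a =>
      obtain ⟨v', u', hw', hp'⟩ := tapeAt_eq_letter.1 h1
      obtain ⟨rfl, rfl⟩ : v = v' ∧ u = a :: u' :=
        List.append_inj (hw.symm.trans hw') (by omega)
      refine (?_ : q' = .rest ∧ p' = p + 1 ∧
        z' = (if a = Fin.last m then 1 else 2) :: z).elim ?_
      · simp only [trans] at h3
        split_ifs at h3 with ha <;> cases h3 <;> rw [move_right_eq] at h4 <;>
          rw [pushdown_push_eq] at h5 <;> simp [h4, h5, ha]
      · rintro rfl ⟨rfl, rfl⟩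
        exact ⟨v ++ [a], u', by simpa using hw, by simp [hp],
          by rw [stack_append_singleton, ← hz]⟩
    | rightEnd =>
      rw [tapeAt_eq_rightEnd] at h1
      cases h3
      rw [move_stay_eq] at h4
      rw [pushdown_keep_eq] at h5
      have hl := congrArg List.length hw
      simp only [List.length_append] at hl
      obtain rfl : u = [] := List.eq_nil_of_length_eq_zero (by omega)
      subst h4 h5 hz
      exact ⟨h1, by rw [hw, List.append_nil]⟩
  | turn =>
    obtain ⟨hp, hz⟩ := hI
    simp only at hp hz
    cases s with
    | rightEnd =>
      cases h3
      rw [move_left_eq] at h4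
      rw [pushdown_keep_eq] at h5
      exact ⟨by simp only; omega, by simp only [h5, hz]⟩
    | _ => cases h3
  | top =>
    obtain ⟨hp, hz⟩ := hI
    simp only at hp hz
    cases s with
    | letter a =>
      simp only [trans] at h3
      split_ifs at h3 with ha ht
      cases h3
      rw [move_left_eq] at h4
      rw [pushdown_keep_eq] at h5
      obtain ⟨v, rfl⟩ := eq_append_of_tapeAt (u := []) (by rw [List.append_nil, ← hp]; exact h1)
      refine ⟨v, 0, a, [], 0, by simp, ?_, rfl, val_lt_of_ne_last ha, by simp, ?_, .inl ht⟩
      · simp at hp; simp only; omega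
      · rw [stack_append_singleton, if_neg ha] at hz
        simp [h5, hz]
    | _ => cases h3
  | verify r a b j =>
    obtain ⟨v, y, c, u, l, hw, hp, hc, hr, hj, hz, hdue⟩ := hI
    simp only at hp hz
    -- Once the remainder is confirmed and exactly `b` letters remain, the block above has length `a
    -- * (y / m) + b`, the image of `y`.
    have done : j = r → l = b → ConwayHalts m tr y := by
      rintro rfl rfl
      rcases hdue with h | ⟨h, X, hX, hH⟩
      · exact conwayHalts_of_none (by rwa [← hj])
      · refine conwayHalts_of_some (hj ▸ h) ?_
        convert hH using 1
        omega
    have hc' : c ≠ Fin.last m := by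
      rintro rfl
      simp at hc
      omega
    cases s with
    | leftEnd =>
      simp only [trans] at h3
      split_ifs at h3 with hjr
      cases h3
      rw [move_stay_eq] at h4
      rw [pushdown_keep_eq] at h5
      subst h4 h5
      exact ⟨v, y, c, u, l, hw, hp, hc', hz, done hjr⟩
    | letter x =>
      simp only [trans] at h3
      by_cases hx : x = Fin.last m
      · rw [if_pos hx] at h3
        obtain ⟨v', rfl⟩ := eq_append_of_tapeAt (u := block m y ++ c :: u)
          (by rw [← List.append_assoc, ← hw, ← hp]; exact h1)
        have e : v' ++ [x] ++ block m y = v' ++ block m (y + 1) := by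
          rw [hx, block, block, List.replicate_succ]; simp
        rw [e] at hw hz
        simp only [List.length_append, List.length_singleton] at hp
        split_ifs at h3 with hjm <;> cases h3 <;> rw [move_left_eq] at h4 <;>
          rw [pushdown_keep_eq] at h5 <;> subst h5
        · have hy := succ_div_mod_of_lt (hj ▸ hjm)
          refine ⟨v', y + 1, c, u, l, hw, by simp only; omega, hc, hr, by rw [hy.1, hj], hz, ?_⟩
          rw [Due, hy.2]
          exact hdue
        · have hy := succ_div_mod_of_le hm (y := y) (by omega)
          refine ⟨v', y + 1, c, u, l, hw, by simp only; omega, hc, hr, hy.1, hz, ?_⟩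
          rw [Due, hy.2]
          refine hdue.imp id fun ⟨h, X, hX, hH⟩ => ⟨h, X, ?_, hH⟩
          rw [mul_add]
          omega
      · rw [if_neg hx] at h3
        split_ifs at h3 with hjr
        cases h3
        rw [move_stay_eq] at h4
        rw [pushdown_keep_eq] at h5
        subst h4 h5
        exact ⟨v, y, c, u, l, hw, hp, hc', hz, done hjr⟩
    | rightEnd => cases h3
  | popA r a b j =>
    obtain ⟨v, y, c, u, l, hw, hp, hc, hr, hy, hz, hdue⟩ := hI
    simp only at hp hz
    cases j with
    | zero =>
      cases h3
      rw [move_stay_eq] at h4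
      rw [pushdown_keep_eq] at h5
      subst h4 h5
      exact ⟨v, y, c, u, l, hw, hp, hc, hr, hy.symm, hz, hdue⟩
    | succ j =>
      simp only [trans] at h3
      split_ifs at h3 with ht
      cases h3
      rw [move_stay_eq] at h4
      rw [pushdown_pop_eq] at h5
      obtain ⟨x, rfl⟩ := h5
      cases l with
      | zero => simp [List.head?] at h2 hz; simp_all
      | succ l =>
        rw [List.replicate_succ, List.cons_append, List.cons.injEq] at hz
        subst h4
        refine ⟨v, y, c, u, l, hw, hp, hc, hr, hy, hz.2, ?_⟩
        refine hdue.imp id fun ⟨h, X, hX, hH⟩ => ⟨h, X, by omega, hH⟩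
  | popB j =>
    obtain ⟨v, y, c, u, l, hw, hp, hc, hz, hH⟩ := hI
    simp only at hp hz
    cases j with
    | zero =>
      simp only [trans] at h3
      split_ifs at h3 with ht
      cases h3
      rw [move_stay_eq] at h4
      rw [pushdown_pop_eq] at h5
      obtain ⟨x, rfl⟩ := h5
      cases l with
      | zero =>
        subst h4
        simp only [List.replicate_zero, List.nil_append, List.cons.injEq] at hz
        exact ⟨v, y, c, u, hw, hp, hc, hz.2, hH rfl⟩
      | succ l => simp [List.replicate_succ] at h2 hz; simp_all
    | succ j =>
      simp only [trans] at h3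
      split_ifs at h3 with ht
      cases h3
      rw [move_stay_eq] at h4
      rw [pushdown_pop_eq] at h5
      obtain ⟨x, rfl⟩ := h5
      cases l with
      | zero => simp [List.head?] at h2 hz; simp_all
      | succ l =>
        rw [List.replicate_succ, List.cons_append, List.cons.injEq] at hz
        subst h4
        exact ⟨v, y, c, u, l, hw, hp, hc, hz.2, fun h => hH (by omega)⟩
  | sep =>
    obtain ⟨v, y, c, u, hw, hp, hc, hz, hH⟩ := hI
    simp only at hp hz
    cases s with
    | leftEnd =>
      rw [tapeAt_eq_leftEnd] at h1
      cases h3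
      obtain rfl : v = [] := List.eq_nil_of_length_eq_zero (by omega)
      have : lead w = y := by rw [hw, List.nil_append, lead_eq hc]
      change ConwayHalts m tr (lead w)
      rwa [this]
    | letter x =>
      simp only [trans] at h3
      split at h3 <;> rename_i ht <;> cases h3
      rename_i a b
      rw [move_left_eq] at h4
      rw [pushdown_keep_eq] at h5
      subst h5
      have hxm := htr _ _ _ ht
      have hx : x ≠ Fin.last m := by rintro rfl; simp at hxm
      obtain ⟨v', rfl⟩ := eq_append_of_tapeAt (u := block m y ++ c :: u)
        (by rw [← List.append_assoc, ← hw, ← hp]; exact h1)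
      refine ⟨v', 0, x, block m y ++ c :: u, y, by rw [hw]; simp, ?_, rfl, hxm, by simp, ?_,
        .inr ⟨ht, y, by simp, hH⟩⟩
      · simp at hp; simp only; omega
      · simp only
        rw [hz, stack_append_block, stack_append_singleton, if_neg hx]
        simp
    | rightEnd => cases h3
  | acc => cases s <;> cases h3 <;> exact hI
  | fin => cases s <;> cases h3

end PushdownHistory

namespace PushdownHistory

section Accepts

variable {m : ℕ} {tr : ℕ → Option (ℕ × ℕ)} {w v u : List (Fin (m + 1))} {x : ℕ}

theorem step_intro {q q' : State} {p p' : ℕ} {z z' : List (Fin 3)} {a : TapeSym (Fin (m + 1))}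
    {t : Fin 3} {i : PushdownInstr (Fin 3)} {d : Dir} (h1 : tapeAt w p = some a)
    (ht : z.head? = some t) (h2 : trans m tr q a t = some (q', i, d))
    (h3 : d.move p = some p') (h4 : (pushdownStore (0 : Fin 3)).apply i z = some z') :
    (machine m tr).step w ⟨q, p, z⟩ = some ⟨q', p', z'⟩ :=
  Machine.step_eq_some.2 ⟨a, t, i, d, h1, ht, h2, h3, h4⟩

theorem exists_head?_stack (v : List (Fin (m + 1))) : ∃ t, (stack v).head? = some t := by
  cases h : stack v with
  | nil => simp [stack] at h
  | cons t s => exact ⟨t, rfl⟩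

theorem acceptsFrom_popA {r a b i p : ℕ} (hp : p ≤ w.length + 1) {t : Fin 3} {z : List (Fin 3)}
    (h : (machine m tr).AcceptsFrom w ⟨.verify r a b 0, p, t :: z⟩) :
    (machine m tr).AcceptsFrom w ⟨.popA r a b i, p, List.replicate i 1 ++ t :: z⟩ := by
  obtain ⟨s, hs⟩ := exists_tapeAt hp
  induction i with
  | zero => exact h.head (step_intro hs rfl rfl rfl rfl)
  | succ i ih => exact ih.head (step_intro hs rfl rfl rfl rfl)

theorem acceptsFrom_popB {i p : ℕ} (hp : p ≤ w.length + 1) {z : List (Fin 3)}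
    (h : (machine m tr).AcceptsFrom w ⟨.sep, p, z⟩) :
    (machine m tr).AcceptsFrom w ⟨.popB i, p, List.replicate i 1 ++ 2 :: z⟩ := by
  obtain ⟨s, hs⟩ := exists_tapeAt hp
  induction i with
  | zero => exact h.head (step_intro hs rfl rfl rfl rfl)
  | succ i ih => exact ih.head (step_intro hs rfl rfl rfl rfl)

/-- The hypothesis on the last letter of `v` makes the machine stop exactly at the left end of the
block, whether a separator or the end marker is there. -/
theorem acceptsFrom_verify (hm : 0 < m) {a b : ℕ} {c : Fin (m + 1)}
    (hw : w = v ++ block m x ++ c :: u) (hv : ∀ c ∈ v.getLast?, c ≠ Fin.last m) {z : List (Fin 3)}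
    (h : (machine m tr).AcceptsFrom w ⟨.sep, v.length, z⟩) :
    (machine m tr).AcceptsFrom w ⟨.verify (x % m) a b 0, v.length + x,
      List.replicate (a * (x / m) + b) 1 ++ 2 :: z⟩ := by
  have hl : w.length = v.length + x + u.length + 1 := by rw [hw]; simp; omega
  have head : ∀ i, ∃ t, (List.replicate i 1 ++ 2 :: z).head? = some t ∧
      ∃ z', List.replicate i 1 ++ 2 :: z = t :: z' := by
    rintro (_ | i)
    exacts [⟨2, rfl, _, rfl⟩, ⟨1, rfl, _, rfl⟩]
  -- When `y` letters have been read, the quotient units still to come account for `a * (x / m - y /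
  -- m)` of the letters that remain to be popped.
  have := Nat.decreasingInduction' (P := fun y => (machine m tr).AcceptsFrom w
    ⟨.verify (x % m) a b (y % m), v.length + (x - y),
      List.replicate (a * (x / m - y / m) + b) 1 ++ 2 :: z⟩) (fun y hy _ ih => ?_)
    (Nat.zero_le x) ?_
  · simpa using this
  · obtain ⟨t, ht, -⟩ := head (a * (x / m - y / m) + b)
    have hs := tapeAt_block_lt (t := Fin.last m) (v := v) (s := c) (u := u) (x := x)
      (y := x - (y + 1)) (by omega)
    rw [← hw] at hs
    have hp : v.length + (x - y) = v.length + (x - (y + 1)) + 1 := by omega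
    rw [hp]
    by_cases hr : y % m + 1 < m
    · rw [(succ_div_mod_of_lt hr).1, (succ_div_mod_of_lt hr).2] at ih
      exact ih.head (step_intro (i := .keep) (d := .left) hs ht (by simp [trans, hr]) rfl rfl)
    · obtain ⟨h1, h2⟩ := succ_div_mod_of_le hm (y := y) (by omega)
      have hle : y / m + 1 ≤ x / m := h2 ▸ Nat.div_le_div_right (c := m) (Nat.succ_le_of_lt hy)
      rw [h1, h2] at ih
      obtain ⟨t', -, z', hz'⟩ := head (a * (x / m - (y / m + 1)) + b)
      rw [hz'] at ih
      have := acceptsFrom_popA (i := a) (by omega) ih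
      rw [← hz', ← List.append_assoc, ← List.replicate_add] at this
      have e : a + (a * (x / m - (y / m + 1)) + b) = a * (x / m - y / m) + b := by
        obtain ⟨k, hk⟩ := Nat.exists_eq_add_of_le hle
        have e1 : x / m - (y / m + 1) = k := by omega
        have e2 : x / m - y / m = k + 1 := by omega
        rw [e1, e2]
        ring
      rw [e] at this
      exact this.head (step_intro (i := .keep) (d := .left) hs ht (by simp [trans, hr]) rfl rfl)
  · rw [Nat.sub_self, Nat.sub_self, mul_zero, zero_add, add_zero]
    obtain ⟨t, ht, -⟩ := head b
    have hpop := acceptsFrom_popB (i := b) (by omega) h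
    obtain ⟨s, hs⟩ := exists_tapeAt (w := w) (p := v.length) (by omega)
    cases s with
    | leftEnd =>
      exact hpop.head (step_intro (i := .keep) (d := .stay) hs ht (by simp [trans]) rfl rfl)
    | letter a =>
      have hs' := hs
      rw [hw, List.append_assoc] at hs'
      obtain ⟨v', hv'⟩ := eq_append_of_tapeAt hs'
      have ha : a ≠ Fin.last m := hv a (by simp [hv'])
      exact hpop.head (step_intro (i := .keep) (d := .stay) hs ht (by simp [trans, ha]) rfl rfl)
    | rightEnd => rw [tapeAt_eq_rightEnd] at hs; omega

/-- The head runs backwards, so later blocks are checked earlier. The statement therefore passes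
acceptance from the point left of block `x`, where everything above has been popped, to acceptance
from the top of the full pushdown. The suffix is again independent of `v`. -/
theorem exists_acceptsFrom_of_haltsIn (hm : 0 < m) {k : ℕ}
    (h : HaltsIn (conwayStep m tr) k x) :
    ∃ c : Fin (m + 1), ∃ u, c ≠ Fin.last m ∧ ∀ v w, w = v ++ block m x ++ c :: u →
      (∀ c ∈ v.getLast?, c ≠ Fin.last m) →
      (machine m tr).AcceptsFrom w ⟨.sep, v.length, stack (v ++ block m x)⟩ →
      (machine m tr).AcceptsFrom w ⟨.top, w.length, stack w⟩ := by
  have hlt : ∀ x, x % m < m + 1 := fun x => (Nat.mod_lt x hm).trans (Nat.lt_succ_self m)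
  have hne : ∀ x, (⟨x % m, hlt x⟩ : Fin (m + 1)) ≠ Fin.last m := fun x e =>
    (Nat.mod_lt x hm).ne (Fin.ext_iff.1 e)
  induction k generalizing x with
  | zero =>
    refine ⟨⟨x % m, hlt x⟩, [], hne x, fun v w hw hv hacc => ?_⟩
    have hx : tr (x % m) = none := by simpa [HaltsIn, conwayStep] using h
    have hs := tapeAt_block_end (t := Fin.last m) (v := v) (s := ⟨x % m, hlt x⟩) (x := x) (u := [])
    rw [← hw] at hs
    have hver := acceptsFrom_verify (a := 0) (b := 0) hm hw hv hacc
    have hst : stack w = 2 :: stack (v ++ block m x) := by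
      rw [hw, stack_append_singleton, if_neg (hne x)]
    have hl : w.length = v.length + x + 1 := by rw [hw]; simp [add_assoc]
    rw [hst, hl]
    refine hver.head (step_intro (i := .keep) (d := .left) hs rfl ?_ rfl (by simp; rfl))
    simp [trans, hne x, hx]
  | succ k ih =>
    obtain ⟨y, hy, h⟩ := h
    obtain ⟨c', u', hc', hu'⟩ := ih h
    refine ⟨⟨x % m, hlt x⟩, block m y ++ c' :: u', hne x, fun v w hw hv hacc => ?_⟩
    obtain ⟨⟨a, b⟩, hx, rfl⟩ : ∃ ab, tr (x % m) = some ab ∧ ab.1 * (x / m) + ab.2 = y := by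
      simpa [conwayStep] using hy
    have hs := tapeAt_block_end (t := Fin.last m) (v := v) (s := ⟨x % m, hlt x⟩) (x := x)
      (u := block m (a * (x / m) + b) ++ c' :: u')
    rw [← hw] at hs
    have hver := acceptsFrom_verify (a := a) (b := b) hm hw hv hacc
    refine hu' (v ++ block m x ++ [⟨x % m, hlt x⟩]) w (by rw [hw]; simp) ?_ ?_
    · intro c hc
      simp at hc
      rw [← hc]
      exact hne x
    · have hst : stack (v ++ block m x ++ [(⟨x % m, hlt x⟩ : Fin (m + 1))] ++
          block m (a * (x / m) + b)) =
          List.replicate (a * (x / m) + b) 1 ++ 2 :: stack (v ++ block m x) := by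
        rw [stack_append_block, stack_append_singleton, if_neg (hne x)]
      obtain ⟨t, ht⟩ := exists_head?_stack (v ++ block m x ++ [(⟨x % m, hlt x⟩ : Fin (m + 1))] ++
        block m (a * (x / m) + b))
      have hl : (v ++ block m x ++ [(⟨x % m, hlt x⟩ : Fin (m + 1))]).length
          = v.length + x + 1 := by simp [add_assoc]
      rw [hl]
      rw [← hst] at hver
      exact hver.head (step_intro (i := .keep) (d := .left) hs ht (by simp [trans, hx]) rfl rfl)

theorem acceptsFrom_acc {p : ℕ} (hp : p ≤ w.length + 1) {z : List (Fin 3)} {t : Fin 3}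
    (ht : z.head? = some t) : (machine m tr).AcceptsFrom w ⟨.acc, p, z⟩ := by
  refine Nat.decreasingInduction' (P := fun p => (machine m tr).AcceptsFrom w ⟨.acc, p, z⟩)
    (fun p hp _ ih => ?_) hp ?_
  · obtain ⟨a, ha⟩ := exists_tapeAt hp.le
    cases a with
    | rightEnd => rw [tapeAt_eq_rightEnd] at ha; omega
    | _ => exact ih.head (step_intro ha ht rfl rfl rfl)
  · exact ⟨⟨.fin, w.length + 2, z⟩,
      .single (step_intro (tapeAt_eq_rightEnd.2 rfl) ht rfl rfl rfl), rfl, rfl⟩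

theorem acceptsFrom_rest (hw : w = v ++ u)
    (h : (machine m tr).AcceptsFrom w ⟨.top, w.length, stack w⟩) :
    (machine m tr).AcceptsFrom w ⟨.rest, v.length + 1, stack v⟩ := by
  obtain ⟨t, ht⟩ := exists_head?_stack v
  induction u generalizing v t with
  | nil =>
    obtain rfl : w = v := by simpa using hw
    have hs := tapeAt_eq_rightEnd.2 (rfl : w.length + 1 = w.length + 1)
    exact (h.head (step_intro (q := .turn) hs ht rfl rfl rfl)).head
      (step_intro hs ht rfl rfl rfl)
  | cons a u ih =>
    obtain ⟨t', ht'⟩ := exists_head?_stack (v ++ [a])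
    have := ih (v := v ++ [a]) (by simp [hw]) t' ht'
    have hs : tapeAt w (v.length + 1) = some (.letter a) := tapeAt_eq_letter.2 ⟨v, u, hw, rfl⟩
    rw [stack_append_singleton, List.length_append, List.length_singleton] at this
    split_ifs at this with ha
    · exact this.head (step_intro (i := .push 1) (d := .right) hs ht (by simp [trans, ha]) rfl rfl)
    · exact this.head (step_intro (i := .push 2) (d := .right) hs ht (by simp [trans, ha]) rfl rfl)

theorem reaches_mark {n : ℕ} {c : Fin (m + 1)} (hc : c ≠ Fin.last m)
    (hw : w = block m n ++ c :: u) :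
    (machine m tr).Reaches w (machine m tr).initConfig ⟨.mark, n + 1, stack (block m n)⟩ := by
  have load : ∀ k ≤ n, (machine m tr).Reaches w (machine m tr).initConfig
      ⟨.load, k + 1, stack (block m k)⟩ := by
    intro k
    induction k with
    | zero => exact fun _ => .single (step_intro (tapeAt_eq_leftEnd.2 rfl) rfl rfl rfl rfl)
    | succ k ih =>
      intro hk
      have hs := tapeAt_block_lt (t := Fin.last m) (v := []) (s := c) (u := u) (x := n) (y := k) hk
      rw [List.nil_append, ← hw, List.length_nil, zero_add] at hs
      obtain ⟨t, ht⟩ := exists_head?_stack (block m k)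
      refine (ih (by omega)).tail
        (step_intro (i := .push 1) (d := .right) hs ht (by simp [trans]) rfl ?_)
      simp [pushdownStore, block, List.replicate_succ', stack_append_singleton]
  obtain ⟨t, ht⟩ := exists_head?_stack (block m n)
  exact (load n le_rfl).tail (step_intro (i := .keep) (d := .stay)
    (tapeAt_eq_letter.2 ⟨_, _, hw, by simp⟩) ht (by simp [trans, hc]) rfl rfl)

theorem acceptsFrom_mark {n : ℕ} {c : Fin (m + 1)} (hc : c ≠ Fin.last m)
    (hw : w = block m n ++ c :: u)
    (h : (machine m tr).AcceptsFrom w ⟨.top, w.length, stack w⟩) :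
    (machine m tr).AcceptsFrom w ⟨.mark, n + 1, stack (block m n)⟩ := by
  have := acceptsFrom_rest (v := block m n ++ [c]) (u := u) (by simp [hw]) h
  rw [stack_append_singleton, if_neg hc, List.length_append, List.length_singleton,
    List.length_replicate] at this
  obtain ⟨t, ht⟩ := exists_head?_stack (block m n)
  exact this.head (step_intro (tapeAt_eq_letter.2 ⟨_, _, hw, by simp⟩) ht rfl rfl rfl)

end Accepts

variable {m : ℕ} {tr : ℕ → Option (ℕ × ℕ)}

/-- At `mark` only the first block has been pushed, so the store word is the bottom symbol followed
by `n` ones and determines the starting number. -/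
theorem mark_mem_storeLanguage (hm : 0 < m) (htr : ∀ r a b, tr r = some (a, b) → r < m) (n : ℕ) :
    Sum.inl State.mark :: (0 :: List.replicate n 1 : List (Fin 3)).map Sum.inr ∈
      (machine m tr).storeLanguage ↔ ConwayHalts m tr n := by
  have hstack : ∀ n, (stack (block m n)).reverse = 0 :: List.replicate n 1 := by
    intro n
    rw [← List.nil_append (block m n), stack_append_block]
    simp [stack]
  constructor
  · rintro ⟨w, c, N, h, j, hj, hu⟩
    have inv := h.1.invariant (Inv m tr w) ⟨rfl, rfl⟩ (inv_step hm htr)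
    simp only [List.cons.injEq, Sum.inl.injEq, List.map_inj_right fun _ _ => Sum.inr.inj] at hu
    have hmark := inv j hj
    simp only [Inv, ← hu.1] at hmark
    have hz : n = lead w := by
      have := hu.2
      simp only [pushdownStore, hmark.1, hstack] at this
      simpa using congrArg List.length this
    have hfin := inv N le_rfl
    have hstate : (c N).state = .fin := h.2.1
    simp only [Inv, hstate] at hfin
    rwa [hz]
  · rintro ⟨k, hk⟩
    obtain ⟨c, u, hc, hu⟩ := exists_acceptsFrom_of_haltsIn hm hk
    obtain ⟨t, ht⟩ := exists_head?_stack ([] ++ block m n)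
    have hsep : (machine m tr).AcceptsFrom (block m n ++ c :: u)
        ⟨.sep, 0, stack ([] ++ block m n)⟩ :=
      (acceptsFrom_acc (Nat.zero_le _) ht).head
        (step_intro (tapeAt_eq_leftEnd.2 rfl) ht rfl rfl rfl)
    obtain ⟨f, N, h, j, hj, hf⟩ := Machine.exists_isAccepting (reaches_mark hc rfl)
      (acceptsFrom_mark hc rfl (hu [] _ rfl (by simp) hsep))
    refine ⟨_, f, N, h, j, hj, ?_⟩
    rw [hf]
    simp only [pushdownStore, hstack]

/-- The pass in which a state occurs: pushing, popping or accepting. -/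
def State.pass : State → Fin 3
  | .init | .load | .mark | .rest => 0
  | .turn | .top | .verify .. | .popA .. | .popB _ | .sep => 1
  | .acc | .fin => 2

/-- One inspection of the transitions yields both machine properties. The passes succeed each other
with a fixed head direction each, which gives at most three crossings; pushing belongs to the first
pass and popping to the second, which gives one turn. -/
theorem step_pass {w : List (Fin (m + 1))} {c c' : Config State (List (Fin 3))}
    (h : (machine m tr).step w c = some c') :
    c.state.pass ≤ c'.state.pass ∧ (c.state.pass ≠ 1 → c.pos ≤ c'.pos) ∧
      (c.state.pass = 1 → c'.pos ≤ c.pos) ∧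
      (c.store.length < c'.store.length → c.state.pass = 0) ∧
      (c'.store.length < c.store.length → c.state.pass = 1) := by
  obtain ⟨s, t, i, d, h1, -, h3, h4, h5⟩ := Machine.step_eq_some.1 h
  obtain ⟨q, p, z⟩ := c
  obtain ⟨q', p', z'⟩ := c'
  simp only [machine] at h1 h3 h4 h5
  unfold trans at h3
  split at h3 <;> (try split at h3) <;> (try split at h3) <;> cases h3 <;>
    first
      | rw [pushdown_keep_eq] at h5
      | rw [pushdown_push_eq] at h5
      | (rw [pushdown_pop_eq] at h5; obtain ⟨x, rfl⟩ := h5)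
  all_goals first
    | rw [move_right_eq] at h4
    | rw [move_stay_eq] at h4
    | rw [move_left_eq] at h4
  all_goals simp_all [State.pass]

theorem crossings_machine_le {w : List (Fin (m + 1))} {c : ℕ → Config State (List (Fin 3))} {n : ℕ}
    (h : (machine m tr).IsComputation w c n) (r : ℕ) : Machine.crossings c n r ≤ 3 :=
  Machine.crossings_le h.2 State.pass (fun k _ => k) (fun k => k ≠ 1)
    (fun _ _ _ _ h => Fin.ext h)
    (fun _ _ h => have h := step_pass h; ⟨h.1, h.2.1, fun h' => h.2.2.1 (not_not.1 h')⟩) r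

theorem not_push_after_pop {w : List (Fin (m + 1))} {c : ℕ → Config State (List (Fin 3))} {n : ℕ}
    (h : (machine m tr).IsComputation w c n) {i j : ℕ} (hij : i < j) (hj : j < n)
    (hpop : (c (i + 1)).store.length < (c i).store.length) :
    ¬ (c j).store.length < (c (j + 1)).store.length := by
  intro hpush
  have mono : ∀ j, i ≤ j → j ≤ n → (c i).state.pass ≤ (c j).state.pass := by
    intro j hij
    induction j, hij using Nat.le_induction with
    | base => intro; exact le_rfl
    | succ j hij ih => exact fun hj => (ih (by omega)).trans (step_pass (h.2 j (by omega))).1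
  have h1 := (step_pass (h.2 i (by omega))).2.2.2.2 hpop
  have h2 := (step_pass (h.2 j hj)).2.2.2.1 hpush
  have h3 := mono j hij.le hj.le
  rw [h1, h2] at h3
  exact absurd h3 (by decide)

/-- The tag and the parameters of a state. -/
def State.code : State → ℕ × ℕ × ℕ × ℕ × ℕ
  | .init => (0, 0, 0, 0, 0)
  | .load => (1, 0, 0, 0, 0)
  | .mark => (2, 0, 0, 0, 0)
  | .rest => (3, 0, 0, 0, 0)
  | .turn => (4, 0, 0, 0, 0)
  | .top => (5, 0, 0, 0, 0)
  | .verify r a b j => (6, r, a, b, j)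
  | .popA r a b i => (7, r, a, b, i)
  | .popB i => (8, i, 0, 0, 0)
  | .sep => (9, 0, 0, 0, 0)
  | .acc => (10, 0, 0, 0, 0)
  | .fin => (11, 0, 0, 0, 0)

theorem State.code_injective : Function.Injective State.code := by
  rintro (_ | _) (_ | _) <;> simp [State.code]

/-- The states with parameters at most `B`. -/
def boundedStates (B : ℕ) : Set State := State.code ⁻¹' Set.Iic (11, B, B, B, B)

theorem finite_boundedStates (B : ℕ) : (boundedStates B).Finite :=
  (Set.finite_Iic _).preimage State.code_injective.injOn

theorem trans_mem_boundedStates {B : ℕ} (hmB : m ≤ B)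
    (htr : ∀ r a b, tr r = some (a, b) → r < m ∧ a ≤ B ∧ b ≤ B) (q : State)
    (hq : q ∈ boundedStates B) (a : TapeSym (Fin (m + 1))) (t : Fin 3) (q' : State)
    (i : PushdownInstr (Fin 3)) (d : Dir) (h : trans m tr q a t = some (q', i, d)) :
    q' ∈ boundedStates B := by
  simp only [boundedStates, Set.mem_preimage, Set.mem_Iic] at hq ⊢
  unfold trans at h
  split at h <;> (try split at h) <;> (try split at h) <;> cases h <;>
    simp only [State.code, Prod.mk_le_mk] at hq ⊢ <;> try omega
  have := htr _ _ _ ‹_›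
  omega

/-- A finite-crossing one-turn pushdown automaton with a store language that is not recursive. -/
theorem exists_pushdownMachine :
    ∃ (a q g : ℕ) (Z₀ : Fin g) (M : PushdownMachine (Fin a) (Fin q) Z₀),
      M.FiniteCrossing ∧ M.OneTurn ∧ ¬ IsRecursive M.storeLanguage := by
  obtain ⟨m, tr, B, hm, hmB, htr, hund⟩ := exists_bounded_conwayHalts_undecidable
  obtain ⟨k, M, e, d, hcomp, -, hstore⟩ := (machine m tr).exists_fin_machine
    (finite_boundedStates B) (by simp [machine, boundedStates, State.code])
    (trans_mem_boundedStates hmB htr)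
  refine ⟨m + 1, k, 3, 0, M, ⟨3, fun w c n h r => crossings_machine_le (hcomp w c n h.1) r⟩,
    fun w c n h i j hij hj hpop => not_push_after_pop (hcomp w c n h) hij hj hpop,
    not_isRecursive hund [Sum.inl (e .mark), Sum.inr 0] (Sum.inr 1) fun n => ?_⟩
  rw [← mark_mem_storeLanguage hm (fun r a b h => (htr r a b h).1) n,
    ← hstore _ (by simp [boundedStates, State.code])]
  simp

end PushdownHistory

end TwoWay

theorem mainTheorem10 :
    (∃ (a q : ℕ) (M : TwoWay.CounterMachine (Fin a) (Fin q)),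
      TwoWay.IsBounded M.language ∧ ¬ TwoWay.IsRecursive M.storeLanguage) ∧
    (∃ (a q : ℕ) (M : TwoWay.CounterMachine (Fin a) (Fin q)),
      M.FiniteCrossing ∧ ¬ TwoWay.IsRecursive M.storeLanguage) ∧
    (∃ (a q g : ℕ) (Z₀ : Fin g) (M : TwoWay.PushdownMachine (Fin a) (Fin q) Z₀),
      M.FiniteCrossing ∧ M.OneTurn ∧ ¬ TwoWay.IsRecursive M.storeLanguage) :=
  ⟨TwoWay.Bounded.exists_counterMachine, TwoWay.CounterHistory.exists_counterMachine,
    TwoWay.PushdownHistory.exists_pushdownMachine⟩
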